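/- Let $n\ge 0$. Let $L^n$ be the set of complex Lie algebra laws on $\mathbb C^n$, i.e. of bilinear skew-symmetric maps $\mu:\mathbb C^n\times\mathbb C^n\to\mathbb C^n$ satisfying the Jacobi identity; it is identified through the structure constants $C_{ij}^k$ ($1\le i<j\le n$, $1\le k\le n$) with an algebraic subset of $\mathbb C^{(n^3-n^2)/2}$ and carries the Zariski topology. Let $\mathcal L^n=\operatorname{Spm}A(L^n)$ be the affine scheme of $A(L^n)=\mathbb C[C_{ij}^k]/I_J$, where $I_J$ is the ideal generated by the Jacobi polynomials; its points $x$ are the maximal ideals of $A(L^n)$ and correspond bijectively to the laws $\mathfrak g_x\in L^n$. The group $GL(n,\mathbb C)$ acts on $L^n$ by $(f*\mu)(X,Y)=f^{-1}(\mu(f(X),f(Y)))$; two laws are isomorphic when they lie in the same orbit, and $\mathcal O(\mathfrak g)$ denotes the orbit of $\mathfrak g$. Its dimension is its dimension as a locally closed subvariety of $L^n$ (Krull dimension in the Zariski topology). A law $\mathfrak g$ is a contraction of $\mathfrak g'$ if $\mathfrak g\in\overline{\mathcal O(\mathfrak g')}$ (Zariski closure in $L^n$). Let $H^i(\mathfrak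 g,\mathfrak g)$ be the Chevalley cohomology of $\mathfrak g$ with values in its adjoint module. (1) Let $x\in\mathcal L^n$ and let $\mathfrak g=\mathfrak g_x$. If $H^1(\mathfrak g,\mathfrak g)=0$, then there is a (Zariski) open neighborhood $U$ of $x$ in $\mathcal L^n$ such that for every $y\in U$ $$\dim\mathcal O(\mathfrak g_y)=n^2-n+\dim H^0(\mathfrak g,\mathfrak g).$$ In particular the dimension of the orbits is constant on $U$. (2) If $\mathfrak g,\mathfrak g'\in L^n$, $H^1(\mathfrak g,\mathfrak g)=0$ and $\mathfrak g$ is a contraction of $\mathfrak g'$, then $\mathfrak g$ and $\mathfrak g'$ are isomorphic. -/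

import Mathlib

noncomputable section

/-- A Lie algebra law on `ℂⁿ`: a bilinear, skew-symmetric map `ℂⁿ × ℂⁿ → ℂⁿ` satisfying the
Jacobi identity. The type `LieLaw n` is the set `Lⁿ`. -/
@[ext]
structure LieLaw (n : ℕ) where
  /-- the bracket -/
  toFun : (Fin n → ℂ) →ₗ[ℂ] (Fin n → ℂ) →ₗ[ℂ] (Fin n → ℂ)
  skew : ∀ X Y, toFun X Y = -toFun Y X
  jacobi : ∀ X Y Z,
    toFun X (toFun Y Z) + toFun Y (toFun Z X) + toFun Z (toFun X Y) = 0

namespace LieLaw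

variable {n : ℕ}

/-- The transported law `(f * μ)(X, Y) = f⁻¹ (μ (f X, f Y))`. -/
def act (f : (Fin n → ℂ) ≃ₗ[ℂ] (Fin n → ℂ)) (μ : LieLaw n) : LieLaw n where
  toFun := (μ.toFun.compl₁₂ (f : (Fin n → ℂ) →ₗ[ℂ] (Fin n → ℂ))
    (f : (Fin n → ℂ) →ₗ[ℂ] (Fin n → ℂ))).compr₂ (f.symm : (Fin n → ℂ) →ₗ[ℂ] (Fin n → ℂ))
  skew X Y := by
    have h := μ.skew (f X) (f Y)
    simp [h]
  jacobi X Y Z := by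
    have h := congrArg f.symm (μ.jacobi (f X) (f Y) (f Z))
    simpa using h

theorem act_apply (f : (Fin n → ℂ) ≃ₗ[ℂ] (Fin n → ℂ)) (μ : LieLaw n) (X Y : Fin n → ℂ) :
    (act f μ).toFun X Y = f.symm (μ.toFun (f X) (f Y)) := rfl

/-- `μ` and `μ'` are isomorphic if `μ' = f * μ` for some `f ∈ GL(n, ℂ)`. -/
def Isomorphic (μ μ' : LieLaw n) : Prop :=
  ∃ f : (Fin n → ℂ) ≃ₗ[ℂ] (Fin n → ℂ), μ' = act f μ

/-- The orbit `O(μ)` of `μ` under `GL(n, ℂ)`: the set of the laws isomorphic to `μ`. -/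
def orbit (μ : LieLaw n) : Set (LieLaw n) := {μ' | Isomorphic μ μ'}

/-! ### Chevalley cohomology with values in the adjoint module, in degrees `0` and `1` -/

/-- The coboundary `C⁰(g,g) = g → C¹(g,g) = End(g)`, `(δ⁰X)(Y) = μ(Y, X)`. -/
def delta0 (μ : LieLaw n) : (Fin n → ℂ) →ₗ[ℂ] ((Fin n → ℂ) →ₗ[ℂ] (Fin n → ℂ)) :=
  μ.toFun.flip

/-- The coboundary of a `1`-cochain,
`(δ¹g)(X, Y) = -g (μ(X, Y)) + μ(g X, Y) + μ(X, g Y)`. Its values are alternating maps;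
they are recorded here as bilinear maps. -/
def delta1 (μ : LieLaw n) : ((Fin n → ℂ) →ₗ[ℂ] (Fin n → ℂ)) →ₗ[ℂ]
    ((Fin n → ℂ) →ₗ[ℂ] (Fin n → ℂ) →ₗ[ℂ] (Fin n → ℂ)) where
  toFun g := -(μ.toFun.compr₂ g) + μ.toFun.comp g + μ.toFun.compl₂ g
  map_add' g h := by
    ext i j k
    simp
    ring
  map_smul' c g := by
    ext i j k
    simp

theorem delta1_apply (μ : LieLaw n) (g : (Fin n → ℂ) →ₗ[ℂ] (Fin n → ℂ)) (X Y : Fin n → ℂ) :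
    delta1 μ g X Y = -g (μ.toFun X Y) + μ.toFun (g X) Y + μ.toFun X (g Y) := rfl

theorem range_delta0_le_ker_delta1 (μ : LieLaw n) :
    LinearMap.range (delta0 μ) ≤ LinearMap.ker (delta1 μ) := by
  rintro _ ⟨Z, rfl⟩
  rw [LinearMap.mem_ker]
  refine LinearMap.ext fun X => LinearMap.ext fun Y => ?_
  have h := μ.jacobi X Y Z
  rw [μ.skew Z (μ.toFun X Y), μ.skew Z X, map_neg, μ.skew Y (μ.toFun X Z), neg_neg] at h
  rw [delta1_apply]
  simp only [delta0, LinearMap.flip_apply, LinearMap.zero_apply]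
  rw [← h]
  abel

/-- `H⁰(g, g) = Ker δ⁰`, the centre of `g`. -/
abbrev H0 (μ : LieLaw n) : Submodule ℂ (Fin n → ℂ) := LinearMap.ker (delta0 μ)

set_option maxSynthPendingDepth 5 in
/-- `H¹(g, g) = Ker δ¹ / Im δ⁰`, derivations modulo inner derivations. -/
abbrev H1 (μ : LieLaw n) : Type :=
  LinearMap.ker (delta1 μ) ⧸ (LinearMap.range (delta0 μ)).submoduleOf (LinearMap.ker (delta1 μ))

end LieLaw

/-! ### Structure constants, the variety `Lⁿ` and the scheme `𝓛ⁿ` -/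

/-- Indices `((i, j), k)` with `i < j` of the independent structure constants `C_{ij}^k`. -/
abbrev StructIdx (n : ℕ) : Type := {p : Fin n × Fin n // p.1 < p.2} × Fin n

namespace LieLaw

variable {n : ℕ}

/-- The `k`-th coordinate of `μ(e_i, e_j)`. -/
def structConst (μ : LieLaw n) (i j k : Fin n) : ℂ :=
  μ.toFun (Pi.single i 1) (Pi.single j 1) k

/-- The point of `ℂ^N`, `N = (n³ - n²)/2`, given by the structure constants of `μ`. -/
def coords (μ : LieLaw n) : StructIdx n → ℂ := fun p => μ.structConst p.1.1.1 p.1.1.2 p.2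

/-- The Zariski topology of `Lⁿ`: the closed sets are those defined by polynomial equations in
the structure constants. -/
instance zariskiTopology : TopologicalSpace (LieLaw n) :=
  TopologicalSpace.ofClosed
    {Z | ∃ S : Set (MvPolynomial (StructIdx n) ℂ),
      Z = {μ : LieLaw n | ∀ P ∈ S, MvPolynomial.eval μ.coords P = 0}}
    ⟨{1}, by ext μ; simp⟩
    (by
      intro A hA
      have hA' : ∀ Z ∈ A, ∃ S : Set (MvPolynomial (StructIdx n) ℂ),
          Z = {μ : LieLaw n | ∀ P ∈ S, MvPolynomial.eval μ.coords P = 0} := fun Z hZ => hA hZ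
      choose! S hS using hA'
      refine ⟨⋃ Z ∈ A, S Z, ?_⟩
      ext μ
      simp only [Set.mem_sInter, Set.mem_iUnion, Set.mem_ofPred_eq]
      constructor
      · rintro h P ⟨Z, hZ, hP⟩
        have h' := h Z hZ
        rw [hS Z hZ] at h'
        exact h' P hP
      · intro h Z hZ
        rw [hS Z hZ]
        exact fun P hP => h P ⟨Z, hZ, hP⟩)
    (by
      rintro _ ⟨S, rfl⟩ _ ⟨T, rfl⟩
      refine ⟨{R | ∃ P ∈ S, ∃ Q ∈ T, R = P * Q}, ?_⟩
      ext μ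
      simp only [Set.mem_union, Set.mem_ofPred_eq]
      constructor
      · rintro (h | h) _ ⟨P, hP, Q, hQ, rfl⟩
        · simp [h P hP]
        · simp [h Q hQ]
      · intro h
        by_contra! hc
        obtain ⟨⟨P, hP, hP0⟩, Q, hQ, hQ0⟩ := hc
        have := h _ ⟨P, hP, Q, hQ, rfl⟩
        rw [map_mul] at this
        exact (mul_ne_zero hP0 hQ0) this)

theorem isClosed_iff (Z : Set (LieLaw n)) :
    IsClosed Z ↔ ∃ S : Set (MvPolynomial (StructIdx n) ℂ),
      Z = {μ : LieLaw n | ∀ P ∈ S, MvPolynomial.eval μ.coords P = 0} := by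
  rw [← isOpen_compl_iff]
  change Zᶜᶜ ∈ {Z | ∃ S : Set (MvPolynomial (StructIdx n) ℂ),
      Z = {μ : LieLaw n | ∀ P ∈ S, MvPolynomial.eval μ.coords P = 0}} ↔ _
  rw [compl_compl]
  rfl

/-- `μ₀` is a contraction of `μ` if it lies in the Zariski closure in `Lⁿ` of the orbit of `μ`. -/
def IsContraction (μ₀ μ : LieLaw n) : Prop := μ₀ ∈ closure (orbit μ)

/-- The dimension of the orbit `O(μ)`, a locally closed subvariety of `Lⁿ`: its Krull dimension
in the (induced) Zariski topology. -/
def orbitDim (μ : LieLaw n) : WithBot ℕ∞ := topologicalKrullDim (orbit μ)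

end LieLaw

/-- The variable `C_{ij}^k` for arbitrary `i, j, k`, with `C_{ij}^k = -C_{ji}^k`, as an element of
the polynomial ring in the variables with `i < j`. -/
def structVar {n : ℕ} (i j k : Fin n) : MvPolynomial (StructIdx n) ℂ :=
  if h : i < j then MvPolynomial.X (⟨(i, j), h⟩, k)
  else if h : j < i then -MvPolynomial.X (⟨(j, i), h⟩, k)
  else 0

/-- The Jacobi polynomial
`∑ₗ C_{ij}^l C_{lk}^s + C_{jk}^l C_{li}^s + C_{ki}^l C_{lj}^s`. -/
def jacobiPoly {n : ℕ} (i j k s : Fin n) : MvPolynomial (StructIdx n) ℂ :=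
  ∑ l : Fin n, (structVar i j l * structVar l k s + structVar j k l * structVar l i s
    + structVar k i l * structVar l j s)

/-- The Jacobi ideal `I_J`. -/
def jacobiIdeal (n : ℕ) : Ideal (MvPolynomial (StructIdx n) ℂ) :=
  Ideal.span {P | ∃ i j k s : Fin n, i < j ∧ j < k ∧ P = jacobiPoly i j k s}

/-- The ring `A(Lⁿ) = ℂ[C_{ij}^k] / I_J`. -/
abbrev VarietyRing (n : ℕ) : Type := MvPolynomial (StructIdx n) ℂ ⧸ jacobiIdeal n

/-- The space underlying the affine scheme `𝓛ⁿ = Spm A(Lⁿ)`, with its Zariski topology. -/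
abbrev LieScheme (n : ℕ) : Type := MaximalSpectrum (VarietyRing n)

namespace LieLaw

variable {n : ℕ}

/-! ### The natural bijection between `Lⁿ` and `Spm A(Lⁿ)` -/

theorem toFun_self (μ : LieLaw n) (X : Fin n → ℂ) : μ.toFun X X = 0 :=
  self_eq_neg.mp (μ.skew X X)

theorem eval_structVar (μ : LieLaw n) (i j k : Fin n) :
    MvPolynomial.eval μ.coords (structVar i j k) = μ.structConst i j k := by
  unfold structVar
  split_ifs with h1 h2
  · simp [coords]
  · simp only [map_neg, MvPolynomial.eval_X, coords, structConst]
    rw [μ.skew (Pi.single i 1)]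
    rfl
  · obtain rfl : i = j := le_antisymm (not_lt.mp h2) (not_lt.mp h1)
    simp [structConst, toFun_self]

theorem bilin_expand (B : (Fin n → ℂ) →ₗ[ℂ] (Fin n → ℂ) →ₗ[ℂ] (Fin n → ℂ))
    (v w : Fin n → ℂ) (s : Fin n) :
    B v w s = ∑ l, v l * B (Pi.single l 1) w s := by
  have hv : v = ∑ l, v l • (Pi.single l (1 : ℂ) : Fin n → ℂ) := by
    ext t
    simp [Finset.sum_apply, Pi.single_apply]
  conv_lhs => rw [hv]
  simp [Finset.sum_apply]

theorem eval_jacobiPoly (μ : LieLaw n) (i j k s : Fin n) :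
    MvPolynomial.eval μ.coords (jacobiPoly i j k s) = 0 := by
  have h := congrFun (μ.jacobi (Pi.single k 1) (Pi.single i 1) (Pi.single j 1)) s
  rw [μ.skew (Pi.single k 1), μ.skew (Pi.single i 1) (μ.toFun _ _),
    μ.skew (Pi.single j 1) (μ.toFun _ _)] at h
  simp only [Pi.add_apply, Pi.neg_apply, Pi.zero_apply] at h
  rw [bilin_expand μ.toFun (μ.toFun (Pi.single i 1) (Pi.single j 1)),
    bilin_expand μ.toFun (μ.toFun (Pi.single j 1) (Pi.single k 1)),
    bilin_expand μ.toFun (μ.toFun (Pi.single k 1) (Pi.single i 1))] at h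
  simp only [jacobiPoly, map_sum, map_add, map_mul, eval_structVar, Finset.sum_add_distrib]
  simp only [structConst]
  linear_combination -h

/-- Evaluation of the elements of `A(Lⁿ)` at a law `μ`. -/
def evalHom (μ : LieLaw n) : VarietyRing n →+* ℂ :=
  Ideal.Quotient.lift (jacobiIdeal n) (MvPolynomial.eval μ.coords) (by
    intro P hP
    have : jacobiIdeal n ≤ RingHom.ker (MvPolynomial.eval μ.coords) := by
      refine Ideal.span_le.mpr ?_
      rintro _ ⟨i, j, k, s, -, -, rfl⟩
      exact eval_jacobiPoly μ i j k s
    exact this hP)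

theorem evalHom_mk (μ : LieLaw n) (P : MvPolynomial (StructIdx n) ℂ) :
    evalHom μ (Ideal.Quotient.mk _ P) = MvPolynomial.eval μ.coords P := rfl

theorem evalHom_surjective (μ : LieLaw n) : Function.Surjective (evalHom μ) := fun c =>
  ⟨Ideal.Quotient.mk _ (MvPolynomial.C c), by simp [evalHom_mk]⟩

/-- The point of `𝓛ⁿ` corresponding to the law `μ`: the maximal ideal of the functions
vanishing at `μ`. -/
def toPoint (μ : LieLaw n) : LieScheme n :=
  ⟨RingHom.ker (evalHom μ), RingHom.ker_isMaximal_of_surjective _ (evalHom_surjective μ)⟩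

theorem coords_injective : Function.Injective (coords : LieLaw n → StructIdx n → ℂ) := by
  intro μ ν h
  have hs : ∀ i j k, μ.structConst i j k = ν.structConst i j k := fun i j k => by
    rw [← eval_structVar, ← eval_structVar, h]
  refine LieLaw.ext (LinearMap.pi_ext' fun i => LinearMap.ext_ring
    (LinearMap.pi_ext' fun j => LinearMap.ext_ring (funext fun k => ?_)))
  exact hs i j k

theorem toPoint_injective : Function.Injective (toPoint : LieLaw n → LieScheme n) := by
  intro μ ν h
  refine coords_injective (funext fun p => ?_)
  have hm : Ideal.Quotient.mk (jacobiIdeal n)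
      (MvPolynomial.X p - MvPolynomial.C (μ.coords p)) ∈ (toPoint μ).asIdeal := by
    change evalHom μ _ = 0
    simp [evalHom_mk]
  rw [h] at hm
  change evalHom ν _ = 0 at hm
  rw [evalHom_mk] at hm
  simp only [map_sub, MvPolynomial.eval_X, MvPolynomial.eval_C] at hm
  exact (sub_eq_zero.mp hm).symm

/-- The bilinear map with prescribed structure constants. -/
def bilinOfConst (c : Fin n → Fin n → Fin n → ℂ) :
    (Fin n → ℂ) →ₗ[ℂ] (Fin n → ℂ) →ₗ[ℂ] (Fin n → ℂ) :=
  (Pi.basisFun ℂ (Fin n)).constr ℂ fun i => (Pi.basisFun ℂ (Fin n)).constr ℂ fun j => c i j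

theorem bilinOfConst_single (c : Fin n → Fin n → Fin n → ℂ) (i j : Fin n) :
    bilinOfConst c (Pi.single i 1) (Pi.single j 1) = c i j := by
  have h := (Pi.basisFun ℂ (Fin n)).constr_basis ℂ
    (fun i => (Pi.basisFun ℂ (Fin n)).constr ℂ fun j => c i j) i
  have h' := (Pi.basisFun ℂ (Fin n)).constr_basis ℂ (fun j => c i j) j
  rw [Pi.basisFun_apply] at h h'
  rw [bilinOfConst, h, h']

theorem skew_of_single (B : (Fin n → ℂ) →ₗ[ℂ] (Fin n → ℂ) →ₗ[ℂ] (Fin n → ℂ))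
    (h : ∀ i j, B (Pi.single i 1) (Pi.single j 1) = -B (Pi.single j 1) (Pi.single i 1))
    (X Y : Fin n → ℂ) : B X Y = -B Y X := by
  have : B = -B.flip := LinearMap.pi_ext' fun i => LinearMap.ext_ring
    (LinearMap.pi_ext' fun j => LinearMap.ext_ring (h i j))
  exact congrArg (fun D => D X Y) this

/-- The Jacobi identity may be checked on the standard basis. -/
theorem jacobi_of_single (B : (Fin n → ℂ) →ₗ[ℂ] (Fin n → ℂ) →ₗ[ℂ] (Fin n → ℂ))
    (h : ∀ i j k, B (Pi.single i 1) (B (Pi.single j 1) (Pi.single k 1))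
      + B (Pi.single j 1) (B (Pi.single k 1) (Pi.single i 1))
      + B (Pi.single k 1) (B (Pi.single i 1) (Pi.single j 1)) = 0)
    (X Y Z : Fin n → ℂ) : B X (B Y Z) + B Y (B Z X) + B Z (B X Y) = 0 := by
  have key : ∀ Y Z : Fin n → ℂ, (∀ i, B (Pi.single i 1) (B Y Z) + B Y (B Z (Pi.single i 1))
      + B Z (B (Pi.single i 1) Y) = 0) → ∀ X, B X (B Y Z) + B Y (B Z X) + B Z (B X Y) = 0 := by
    intro Y Z hi X
    have : B.flip (B Y Z) + B Y ∘ₗ B Z + B Z ∘ₗ B.flip Y = 0 :=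
      LinearMap.pi_ext' fun i => LinearMap.ext_ring (hi i)
    exact congrArg (fun D => D X) this
  have cyc : ∀ X Y Z : Fin n → ℂ, B Y (B Z X) + B Z (B X Y) + B X (B Y Z)
      = B X (B Y Z) + B Y (B Z X) + B Z (B X Y) := fun X Y Z => by abel
  refine key Y Z (fun i => ?_) X
  rw [← cyc]
  refine key Z (Pi.single i 1) (fun j => ?_) Y
  rw [← cyc]
  exact key (Pi.single i 1) (Pi.single j 1) (fun k => by rw [← cyc]; exact h i j k) Z

theorem toPoint_surjective : Function.Surjective (toPoint : LieLaw n → LieScheme n) := by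
  intro y
  let q := Ideal.Quotient.mk (jacobiIdeal n)
  have hmax : (y.asIdeal.comap q).IsMaximal :=
    Ideal.comap_isMaximal_of_surjective q Ideal.Quotient.mk_surjective (H := y.isMaximal)
  obtain ⟨x, hx⟩ := (MvPolynomial.isMaximal_iff_eq_vanishingIdeal_singleton).mp hmax
  have hev : ∀ P, P ∈ y.asIdeal.comap q ↔ MvPolynomial.eval x P = 0 := fun P => by
    rw [hx, MvPolynomial.mem_vanishingIdeal_singleton_iff]
    rfl
  let c : Fin n → Fin n → Fin n → ℂ := fun i j k => MvPolynomial.eval x (structVar i j k)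
  let B := bilinOfConst c
  have hBs : ∀ i j, B (Pi.single i 1) (Pi.single j 1) = c i j := bilinOfConst_single c
  have hskew : ∀ X Y, B X Y = -B Y X := by
    refine skew_of_single B fun i j => ?_
    rw [hBs, hBs]
    funext k
    rcases lt_trichotomy i j with hij | rfl | hij
    · simp [c, structVar, hij, hij.not_gt]
    · simp [c, structVar]
    · simp [c, structVar, hij, hij.not_gt]
  have hself : ∀ X, B X X = 0 := fun X => self_eq_neg.mp (hskew X X)
  let J : Fin n → Fin n → Fin n → Fin n → ℂ := fun i j k =>
    B (Pi.single i 1) (B (Pi.single j 1) (Pi.single k 1))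
      + B (Pi.single j 1) (B (Pi.single k 1) (Pi.single i 1))
      + B (Pi.single k 1) (B (Pi.single i 1) (Pi.single j 1))
  have hJlt : ∀ i j k, i < j → j < k → J i j k = 0 := by
    intro i j k hij hjk
    funext s
    have hmem : jacobiPoly i j k s ∈ y.asIdeal.comap q := by
      have h0 : q (jacobiPoly i j k s) = 0 := Ideal.Quotient.eq_zero_iff_mem.mpr
        (Ideal.subset_span ⟨i, j, k, s, hij, hjk, rfl⟩)
      rw [Ideal.mem_comap, h0]
      exact Ideal.zero_mem _
    have h := (hev _).mp hmem
    simp only [jacobiPoly, map_sum, map_add, map_mul, Finset.sum_add_distrib] at h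
    simp only [J]
    rw [hskew (Pi.single i 1) (B _ _), hskew (Pi.single j 1) (B _ _),
      hskew (Pi.single k 1) (B _ _)]
    simp only [Pi.add_apply, Pi.neg_apply, Pi.zero_apply]
    rw [bilin_expand B (B (Pi.single i 1) (Pi.single j 1)),
      bilin_expand B (B (Pi.single j 1) (Pi.single k 1)),
      bilin_expand B (B (Pi.single k 1) (Pi.single i 1))]
    simp only [hBs, c]
    linear_combination -h
  have hJcyc : ∀ i j k, J i j k = J j k i := fun i j k => by simp only [J]; abel
  have hJswap : ∀ i j k, J i j k = -J j i k := fun i j k => by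
    simp only [J]
    rw [hskew (Pi.single j 1) (Pi.single k 1), hskew (Pi.single k 1) (Pi.single i 1),
      hskew (Pi.single i 1) (Pi.single j 1)]
    simp only [map_neg]
    abel
  have hJeq : ∀ i k, J i i k = 0 := fun i k => by
    simp only [J]
    rw [hself, hskew (Pi.single k 1) (Pi.single i 1)]
    simp
  have hJ3 : ∀ i j k, i < j → J i j k = 0 := by
    intro i j k hij
    rcases lt_trichotomy j k with hjk | rfl | hjk
    · exact hJlt i j k hij hjk
    · rw [hJcyc]; exact hJeq j i
    · rcases lt_trichotomy i k with hik | rfl | hik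
      · rw [hJcyc, hJcyc, hJswap, hJlt i k j hik hjk, neg_zero]
      · rw [hJcyc, hJcyc]; exact hJeq i j
      · rw [hJcyc, hJcyc]; exact hJlt k i j hik hij
  have hJ : ∀ i j k, J i j k = 0 := by
    intro i j k
    rcases lt_trichotomy i j with hij | rfl | hij
    · exact hJ3 i j k hij
    · exact hJeq i k
    · rw [hJswap, hJ3 j i k hij, neg_zero]
  let μ : LieLaw n := ⟨B, hskew, jacobi_of_single B hJ⟩
  have hcoords : μ.coords = x := by
    funext p
    obtain ⟨⟨⟨i, j⟩, hij⟩, k⟩ := p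
    have hij' : i < j := hij
    have : μ.coords (⟨⟨i, j⟩, hij⟩, k) = c i j k := congrFun (hBs i j) k
    rw [this]
    simp [c, structVar, hij']
  refine ⟨μ, ?_⟩
  refine MaximalSpectrum.ext (Ideal.ext fun a => ?_)
  obtain ⟨P, rfl⟩ := Ideal.Quotient.mk_surjective a
  change MvPolynomial.eval μ.coords P = 0 ↔ _
  rw [hcoords, ← hev]
  rfl

end LieLaw

/-- The natural bijection between `Lⁿ` and the points of `𝓛ⁿ = Spm A(Lⁿ)`. -/
def pointEquiv (n : ℕ) : LieLaw n ≃ LieScheme n :=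
  Equiv.ofBijective LieLaw.toPoint ⟨LieLaw.toPoint_injective, LieLaw.toPoint_surjective⟩

/-- The Lie algebra law `g_x` corresponding to a point `x` of `𝓛ⁿ`. -/
def lawOfPoint {n : ℕ} (x : LieScheme n) : LieLaw n := (pointEquiv n).symm x

end

/-!
For a law `μ` on `ℂⁿ` let `rank0 μ` and `rank1 μ` be the ranks of the coboundaries `δ⁰` and `δ¹`.
The image of `δ⁰` consists of the inner derivations and the kernel of `δ¹` of all derivations, so
`rank0 μ + rank1 μ ≤ n²`, with equality when `H¹(μ, μ) = 0`. Both ranks are lower semicontinuous,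
hence near a law with `H¹ = 0` neither of them can increase and `rank1` is locally constant
(`exists_polynomial_rank1_eq`), with value `n² - n + dim H⁰`. Both assertions therefore rest on the
equality `dim O(μ) = rank1 μ` (`orbitDim_eq_rank1`): the dimension of the orbit is that of its
tangent space.

Polynomial relations on a set of laws are studied through generic points. An invertible matrix `X`
over a finitely generated `ℂ`-algebra `B` transports `μ` to a law over `B`; its specializations at
the rational points of `B` form a family in the orbit of `μ`, and by the Nullstellensatz the ideal
of this family is the ideal of relations between the structure constants of the law over `B`
(`vanIdeal_family`). For the generic matrix the family is the whole orbit.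

* Upper bound (`ringKrullDim_quotient_vanIdeal_orbit_le`). By Noether normalization the dimension
  of the closure of the orbit is bounded by a number `s` of algebraically independent functions in
  the structure constants of the generic transported law. Each derivation `D` of `μ` induces the
  derivation `X ↦ D X` of the function field of `GL(n)`, which kills these functions. In
  characteristic zero a derivation vanishing on a transcendence basis is zero, so
  `s + dim Der(μ) ≤ n²`.
* Lower bound (`le_orbitDim`). Choose matrices `v₁, …, v_r`, `r = rank1 μ`, with linearly
  independent images under `δ¹`. The families given by `X = 1 + t₁v₁ + ⋯ + tᵢvᵢ` for `i = 0, …, r`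
  increase with `i`. The function field of the `i`-th one has transcendence degree exactly `i`: a
  derivation killing the structure constants kills the parameters, because the corresponding linear
  system is nonsingular at `t = 0` (`trdeg_quotient_vanIdeal_family`). So their closures form a
  strictly increasing chain of irreducible closed subsets of the orbit, and it is not necessary to
  know beforehand that the orbit is open in its closure.

If a law `g` with `H¹ = 0` is a contraction of `g'`, the orbit of `g'` meets the neighbourhood of
`g` on which `rank1` is constant, so both orbits have the same dimension and hence the same closure
(`vanIdeal_orbit_eq_of_mem_closure`). By Chevalley's theorem each orbit contains a nonempty open
subset of its closure, so the two orbits meet (`isomorphic_of_vanIdeal_orbit_eq`).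
-/

/-! ### Derivations and transcendence degrees -/

open scoped TensorProduct

/-- A derivation is determined by its values on a subring over which the target ring is
formally unramified. -/
theorem Derivation.eq_zero_of_formallyUnramified {R S K M : Type*} [CommRing R] [CommRing S]
    [CommRing K] [Algebra R S] [Algebra S K] [Algebra R K] [IsScalarTower R S K]
    [AddCommGroup M] [Module K M] [Module R M] [IsScalarTower R K M]
    [Algebra.FormallyUnramified S K] (d : Derivation R K M)
    (h : ∀ s, d (algebraMap S K s) = 0) : d = 0 := by
  let : Module S M := Module.compHom M (algebraMap S K)
  have : IsScalarTower S K M := IsScalarTower.of_algebraMap_smul fun _ _ => rfl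
  let d' : Derivation S K M :=
    { toFun := d
      map_add' := d.map_add
      map_smul' := fun s x => by
        simp only [Algebra.smul_def, Derivation.leibniz, h, smul_zero, add_zero, RingHom.id_apply]
        rfl
      map_one_eq_zero' := d.map_one_eq_zero
      leibniz' := d.leibniz }
  ext x
  have hx : d' x = 0 := by
    rw [← d'.liftKaehlerDifferential_comp_D, Subsingleton.elim (KaehlerDifferential.D S K x) 0,
      map_zero]
  exact hx

/-- Derivations extend along formally étale algebras, for example to fraction fields. -/
theorem Derivation.exists_extend_of_formallyEtale {R S K : Type*} [CommRing R] [CommRing S]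
    [CommRing K] [Algebra R S] [Algebra S K] [Algebra R K] [IsScalarTower R S K]
    [Algebra.FormallyEtale S K] (d : Derivation R S K) :
    ∃ d' : Derivation R K K, ∀ s, d' (algebraMap S K s) = d s := by
  let e := KaehlerDifferential.tensorKaehlerEquivOfFormallyEtale R S K
  let l : Ω[K⁄R] →ₗ[K] K :=
    (d.liftKaehlerDifferential.liftBaseChange K) ∘ₗ e.symm.toLinearMap
  refine ⟨l.compDer (KaehlerDifferential.D R K), fun s => ?_⟩
  have h := KaehlerDifferential.tensorKaehlerEquivOfFormallyEtale_symm_D_algebraMap R S K s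
  refine (congrArg (LinearMap.liftBaseChange K d.liftKaehlerDifferential) h).trans ?_
  simp

theorem Derivation.eq_zero_on_adjoin {k K : Type*} [Field k] [Field K] [Algebra k K]
    (d : Derivation k K K) {s : Set K} (h : ∀ x ∈ s, d x = 0) {x : K}
    (hx : x ∈ IntermediateField.adjoin k s) : d x = 0 := by
  induction hx using IntermediateField.adjoin_induction with
  | mem x hx => exact h x hx
  | algebraMap x => simp
  | add x y _ _ hx hy => simp [hx, hy]
  | inv x _ hx => simp [Derivation.leibniz_inv, hx]
  | mul x y _ _ hx hy => simp [hx, hy]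

/-- In characteristic zero, a derivation of a field vanishes if it vanishes on a
transcendence basis. -/
theorem Derivation.eq_zero_of_isTranscendenceBasis {k K ι : Type*} [Field k] [Field K]
    [CharZero k] [Algebra k K] (d : Derivation k K K) {b : ι → K} (hb : IsTranscendenceBasis k b)
    (h : ∀ i, d (b i) = 0) : d = 0 := by
  have := hb.isAlgebraic_field
  have : CharZero K := charZero_of_injective_algebraMap (algebraMap k K).injective
  have : Algebra.FormallyUnramified (IntermediateField.adjoin k (Set.range b)) K :=
    Algebra.FormallyUnramified.of_isSeparable _ _
  refine d.eq_zero_of_formallyUnramified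
    (S := IntermediateField.adjoin k (Set.range b)) fun s => ?_
  exact d.eq_zero_on_adjoin (by rintro _ ⟨i, rfl⟩; exact h i) s.2

/-- A family of algebraically independent elements is killed by at most `N - s` linearly
independent derivations, `N` being the transcendence degree. -/
theorem AlgebraicIndependent.add_le_trdeg_of_derivation {k K : Type} [Field k] [Field K]
    [CharZero k] [Algebra k K] {N s m : ℕ} (hN : Algebra.trdeg k K = N) {y : Fin s → K}
    (hy : AlgebraicIndependent k y) (D : Fin m → Derivation k K K) (hD : ∀ c i, D c (y i) = 0)
    (hli : LinearIndependent K D) : s + m ≤ N := by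
  obtain ⟨u, hu, hub⟩ := exists_isTranscendenceBasis_superset hy.to_subtype_range
  have hcard : Cardinal.mk u = N := by rw [hub.cardinalMk_eq_trdeg, hN]
  have hfin : Finite u := Cardinal.lt_aleph0_iff_finite.mp (by
    simp [hcard, Cardinal.natCast_lt_aleph0])
  have hus : (Set.range y).ncard = s := by
    rw [← Set.image_univ, Set.ncard_image_of_injective _ hy.injective]; simp
  have huN : u.ncard = N := by
    have : (Nat.card u : Cardinal) = N := by rw [Nat.cast_card, hcard]
    exact_mod_cast this
  have hdiff := Set.ncard_sdiff_add_ncard_of_subset hu hfin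
  let z := (u \ Set.range y : Set K)
  have hzf : Finite z := Set.Finite.subset hfin Set.sdiff_subset
  have : Fintype z := Fintype.ofFinite z
  suffices hm : m ≤ z.ncard by simp only [z] at hm; omega
  -- derivations killing `y` are determined by their values on the rest `z` of the basis
  let ev : (Derivation k K K) →ₗ[K] (z → K) :=
    { toFun := fun d i => d i
      map_add' := fun _ _ => rfl
      map_smul' := fun _ _ => rfl }
  have hinj : LinearIndependent K (fun c => ev (D c)) := by
    rw [Fintype.linearIndependent_iff] at hli ⊢
    intro g hg
    refine hli g (Derivation.eq_zero_of_isTranscendenceBasis _ hub fun i => ?_)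
    by_cases hi : (i : K) ∈ Set.range y
    · obtain ⟨j, hj⟩ := hi
      rw [← hj, ← Derivation.coeFnAddMonoidHom_apply, map_sum, Finset.sum_apply]
      simp [hD]
    · have h1 := congrFun hg ⟨i, i.2, hi⟩
      rw [← Derivation.coeFnAddMonoidHom_apply, map_sum, Finset.sum_apply]
      simpa [ev] using h1
  have := hinj.fintype_card_le_finrank
  rwa [Fintype.card_fin, Module.finrank_fintype_fun_eq_card, ← Nat.card_eq_fintype_card,
    Nat.card_coe_set_eq] at this

/-- A function field `K` in characteristic zero is algebraic over a subfield `L` if every derivation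
of `K` that vanishes on `L` is zero. -/
theorem isAlgebraic_of_derivation_eq_zero {k K : Type} [Field k] [Field K] [CharZero k]
    [Algebra k K] [Algebra.EssFiniteType k K] (L : IntermediateField k K)
    (h : ∀ d : Derivation k K K, (∀ x ∈ L, d x = 0) → d = 0) : Algebra.IsAlgebraic L K := by
  have : Algebra.EssFiniteType L K := Algebra.EssFiniteType.of_comp k L K
  have hs : Subsingleton (Ω[K⁄L]) := by
    by_contra hns
    rw [not_subsingleton_iff_nontrivial] at hns
    obtain ⟨w, hw⟩ := exists_ne (0 : Ω[K⁄L])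
    obtain ⟨f, hf⟩ : ∃ f : Ω[K⁄L] →ₗ[K] K, f ≠ 0 := by
      by_contra! hall
      exact hw ((Module.forall_dual_apply_eq_zero_iff K w).mp fun f => by simp [hall f])
    have hd := h ((f.compDer (KaehlerDifferential.D L K)).restrictScalars k) (fun x hx => by
      have := (KaehlerDifferential.D L K).map_algebraMap ⟨x, hx⟩
      change f (KaehlerDifferential.D L K x) = 0
      rw [show KaehlerDifferential.D L K x = 0 from this, map_zero])
    refine hf (LinearMap.ext_on (KaehlerDifferential.span_range_derivation L K) ?_)
    rintro _ ⟨x, rfl⟩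
    exact DFunLike.congr_fun hd x
  have : Algebra.FormallyUnramified L K := ⟨hs⟩
  have := Algebra.FormallyUnramified.isSeparable L K
  infer_instance

theorem derivation_aeval_eq_zero {R σ : Type*} [CommRing R] [Algebra ℂ R] (d : Derivation ℂ R R)
    {c : σ → R} (hc : ∀ p, d (c p) = 0) (P : MvPolynomial σ ℂ) :
    d (MvPolynomial.aeval c P) = 0 := by
  induction P using MvPolynomial.induction_on with
  | C a => simp
  | add p q hp hq => simp [hp, hq]
  | mul_X p i hp => simp [hp, hc]

/-- The algebra generated by the functions `c` has the transcendence degree of any algebraic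
extension field of it. -/
theorem trdeg_quotient_ker_aeval {k K ι : Type} [Field k] [Field K] [Algebra k K] (c : ι → K)
    [Algebra.IsAlgebraic (Algebra.adjoin k (Set.range c)) K] :
    Algebra.trdeg k (MvPolynomial ι k ⧸ RingHom.ker (MvPolynomial.aeval (R := k) c)) =
      Algebra.trdeg k K := by
  rw [(Ideal.quotientKerEquivRange (MvPolynomial.aeval (R := k) c)).trdeg_eq,
    ← Algebra.adjoin_range_eq_range_aeval]
  have htr := trdeg_add_eq k (Algebra.adjoin k (Set.range c)) (A := K)
  rwa [trdeg_eq_zero (R := Algebra.adjoin k (Set.range c)), add_zero] at htr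

/-! ### Krull dimension, rational points and images of morphisms -/

/-- The Krull dimension of a ring does not exceed that of a subring over which it is integral. -/
theorem ringKrullDim_le_of_isIntegral {R S : Type*} [CommRing R] [CommRing S] (f : R →+* S)
    (hf : f.IsIntegral) : ringKrullDim S ≤ ringKrullDim R := by
  refine Order.krullDim_le_of_strictMono (PrimeSpectrum.comap f) fun p q hpq => ?_
  algebraize [f]
  have : Algebra.IsIntegral R S := ⟨hf⟩
  exact Ideal.IsIntegral.comap_lt_comap (R := R) hpq

/-- **Nullstellensatz**: a nontrivial finitely generated algebra over an algebraically closed field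
has a rational point. -/
theorem exists_algHom_of_finiteType (k A : Type*) [Field k] [IsAlgClosed k] [CommRing A]
    [Algebra k A] [Algebra.FiniteType k A] [Nontrivial A] : Nonempty (A →ₐ[k] k) := by
  obtain ⟨m, hm⟩ := Ideal.exists_maximal A
  let := Ideal.Quotient.field m
  have : Module.Finite k (A ⧸ m) := finite_of_finite_type_of_isJacobsonRing k (A ⧸ m)
  have hb := IsAlgClosed.algebraMap_bijective_of_isIntegral (k := k) (K := A ⧸ m)
  exact ⟨((AlgEquiv.ofBijective (Algebra.ofId k (A ⧸ m)) hb).symm : (A ⧸ m) →ₐ[k] k).comp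
    (Ideal.Quotient.mkₐ k m)⟩

/-- A nonzero function on an affine variety is nonzero at some rational point: the localization at
that function has a rational point. -/
theorem exists_algHom_apply_ne_zero {k A : Type*} [Field k] [IsAlgClosed k] [CommRing A]
    [IsDomain A] [Algebra k A] [Algebra.FiniteType k A] {a : A} (ha : a ≠ 0) :
    ∃ e : A →ₐ[k] k, e a ≠ 0 := by
  have : Nontrivial (Localization.Away a) :=
    (IsLocalization.injective (Localization.Away a)
      (powers_le_nonZeroDivisors_of_noZeroDivisors ha)).nontrivial
  have : Algebra.FiniteType A (Localization.Away a) :=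
    IsLocalization.finiteType_of_monoid_fg (Submonoid.powers a) _
  have : Algebra.FiniteType k (Localization.Away a) :=
    Algebra.FiniteType.trans (S := A) inferInstance inferInstance
  obtain ⟨e⟩ := exists_algHom_of_finiteType k (Localization.Away a)
  refine ⟨e.comp (IsScalarTower.toAlgHom k A _), ?_⟩
  have := (IsLocalization.Away.algebraMap_isUnit (S := Localization.Away a) a).map e
  exact this.ne_zero

/-- The image of a morphism of affine varieties contains a nonempty open subset of its closure:
consequence of Chevalley's theorem in terms of rational points. -/
theorem exists_forall_exists_comp_eq {k A B : Type*} [Field k] [IsAlgClosed k] [CommRing A]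
    [CommRing B] [IsDomain B] [Algebra k A] [Algebra k B] [Algebra.FiniteType k A]
    [Algebra.FiniteType k B] (φ : A →ₐ[k] B) :
    ∃ a : A, φ a ≠ 0 ∧ ∀ p : A →ₐ[k] k, p a ≠ 0 → RingHom.ker φ ≤ RingHom.ker p →
      ∃ q : B →ₐ[k] k, q.comp φ = p := by
  have : IsNoetherianRing A := Algebra.FiniteType.isNoetherianRing k A
  have hft : (φ : A →+* B).FinitePresentation := by
    refine (RingHom.FinitePresentation.of_finiteType).mp ?_
    refine RingHom.FiniteType.of_comp_finiteType (f := algebraMap k A) ?_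
    rw [AlgHom.comp_algebraMap]
    exact RingHom.finiteType_algebraMap.mpr inferInstance
  -- the image in `Spec A` is constructible and contains the generic point of its closure
  obtain ⟨C, hC⟩ := PrimeSpectrum.exists_constructibleSetData_iff.mpr
    (PrimeSpectrum.isConstructible_range_comap hft)
  have hgen : PrimeSpectrum.comap (φ : A →+* B) ⊥ ∈ C.toSet := by
    rw [hC]; exact ⟨_, rfl⟩
  simp only [PrimeSpectrum.ConstructibleSetData.toSet, Set.mem_iUnion] at hgen
  obtain ⟨c, hc, hcg, hcf⟩ := hgen
  refine ⟨c.f, fun h0 => hcf ?_, fun p hp hker => ?_⟩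
  · simpa [PrimeSpectrum.mem_zeroLocus] using h0
  have hmem : (⟨RingHom.ker p, RingHom.ker_isPrime _⟩ : PrimeSpectrum A) ∈ C.toSet := by
    simp only [PrimeSpectrum.ConstructibleSetData.toSet, Set.mem_iUnion]
    refine ⟨c, hc, fun x hx => hker ?_, fun h => hp ?_⟩
    · simpa using hcg hx
    · simpa using h
  rw [hC] at hmem
  obtain ⟨Q, hQ⟩ := hmem
  have hQ' : RingHom.ker p = Q.asIdeal.comap φ := by
    have := congrArg PrimeSpectrum.asIdeal hQ
    exact this.symm
  obtain ⟨e⟩ := exists_algHom_of_finiteType k (B ⧸ Q.asIdeal)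
  refine ⟨e.comp (Ideal.Quotient.mkₐ k Q.asIdeal), AlgHom.ext fun a => ?_⟩
  have ha : a - algebraMap k A (p a) ∈ RingHom.ker p := by
    simp [RingHom.mem_ker]
  rw [hQ', Ideal.mem_comap, ← Ideal.Quotient.eq_zero_iff_mem] at ha
  have := congrArg e ha
  simp only [map_sub, map_zero, AlgHom.commutes] at this
  simpa [sub_eq_zero] using this

theorem isIrreducible_image_val {X : Type*} [TopologicalSpace X] {T : Set X} {A : Set T} :
    IsIrreducible (Subtype.val '' A) ↔ IsIrreducible A := by
  refine ⟨fun h => ⟨Set.image_nonempty.mp h.nonempty, ?_⟩,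
    fun h => h.image _ continuous_subtype_val.continuousOn⟩
  rintro _ _ ⟨u, hu, rfl⟩ ⟨v, hv, rfl⟩ ⟨x, hx, hxu⟩ ⟨y, hy, hyv⟩
  obtain ⟨_, ⟨z, hz, rfl⟩, hzu, hzv⟩ := h.isPreirreducible u v hu hv
    ⟨x, ⟨x, hx, rfl⟩, hxu⟩ ⟨y, ⟨y, hy, rfl⟩, hyv⟩
  exact ⟨z, hz, hzu, hzv⟩

/-! ### Linear algebra -/

/-- Linearly independent vectors have a dual family. -/
theorem LinearIndependent.exists_dual_family {k ι κ : Type*} [Field k] [Fintype ι] [DecidableEq κ]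
    [Fintype κ] {v : κ → ι → k} (hv : LinearIndependent k v) :
    ∃ Q : Matrix κ ι k, ∀ a b, ∑ x, Q a x * v b x = if a = b then 1 else 0 := by
  classical
  have hM : LinearMap.ker (Matrix.mulVecLin (Matrix.of v).transpose) = ⊥ := by
    rw [LinearMap.ker_eq_bot]
    exact Matrix.mulVec_injective_iff.mpr hv
  obtain ⟨g, hg⟩ := LinearMap.exists_leftInverse_of_injective _ hM
  refine ⟨LinearMap.toMatrix' g, fun a b => ?_⟩
  have h := congrFun (LinearMap.congr_fun hg (Pi.single b 1)) a
  rw [LinearMap.comp_apply, ← LinearMap.toMatrix'_mulVec g, Matrix.mulVecLin_apply,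
    Matrix.mulVec_single_one, LinearMap.id_apply, Pi.single_apply] at h
  exact h

theorem finrank_range_comp_of_injective {V W X : Type*} [AddCommGroup V] [Module ℂ V]
    [AddCommGroup W] [Module ℂ W] [AddCommGroup X] [Module ℂ X] (f : V →ₗ[ℂ] W) {g : W →ₗ[ℂ] X}
    (hg : Function.Injective g) :
    Module.finrank ℂ (LinearMap.range (g ∘ₗ f)) = Module.finrank ℂ (LinearMap.range f) := by
  rw [LinearMap.range_comp]
  exact (Submodule.equivMapOfInjective g hg _).finrank_eq.symm

namespace LieLaw

set_option maxSynthPendingDepth 5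

variable {n : ℕ}

/-! ### Closed sets, irreducible sets and dimension in `Lⁿ` -/

/-- The ideal of the polynomials in the structure constants that vanish on `T`. -/
def vanIdeal (T : Set (LieLaw n)) : Ideal (MvPolynomial (StructIdx n) ℂ) where
  carrier := {P | ∀ μ ∈ T, MvPolynomial.eval μ.coords P = 0}
  add_mem' hP hQ μ hμ := by rw [map_add, hP μ hμ, hQ μ hμ, add_zero]
  zero_mem' μ _ := map_zero _
  smul_mem' P Q hQ μ hμ := by rw [smul_eq_mul, map_mul, hQ μ hμ, mul_zero]

theorem mem_vanIdeal {T : Set (LieLaw n)} {P : MvPolynomial (StructIdx n) ℂ} :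
    P ∈ vanIdeal T ↔ ∀ μ ∈ T, MvPolynomial.eval μ.coords P = 0 := Iff.rfl

theorem vanIdeal_anti {T T' : Set (LieLaw n)} (h : T ⊆ T') : vanIdeal T' ≤ vanIdeal T :=
  fun _ hP μ hμ => hP μ (h hμ)

theorem isClosed_eval_eq_zero (P : MvPolynomial (StructIdx n) ℂ) :
    IsClosed {μ : LieLaw n | MvPolynomial.eval μ.coords P = 0} :=
  (isClosed_iff _).mpr ⟨{P}, by simp⟩

theorem mem_closure_iff_vanIdeal {T : Set (LieLaw n)} {μ : LieLaw n} :
    μ ∈ closure T ↔ ∀ P ∈ vanIdeal T, MvPolynomial.eval μ.coords P = 0 := by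
  constructor
  · intro h P hP
    exact closure_minimal hP (isClosed_eval_eq_zero P) h
  · intro h
    obtain ⟨S, hS⟩ := (isClosed_iff _).mp (isClosed_closure (s := T))
    rw [hS]
    refine fun P hP => h P fun ν hν => ?_
    have hν' := subset_closure hν
    rw [hS] at hν'
    exact hν' P hP

theorem vanIdeal_isPrime {T : Set (LieLaw n)} (hT : IsIrreducible T) : (vanIdeal T).IsPrime := by
  refine ⟨fun h => ?_, fun {P Q} hPQ => ?_⟩
  · obtain ⟨μ, hμ⟩ := hT.nonempty
    have : (1 : MvPolynomial (StructIdx n) ℂ) ∈ vanIdeal T := by rw [h]; trivial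
    simpa using this μ hμ
  · refine isPreirreducible_iff_isClosed_union_isClosed.mp hT.isPreirreducible _ _
      (isClosed_eval_eq_zero P) (isClosed_eval_eq_zero Q) fun μ hμ => ?_
    have := hPQ μ hμ
    rw [map_mul] at this
    exact mul_eq_zero.mp this

theorem isIrreducible_of_vanIdeal_isPrime {T : Set (LieLaw n)} (hT : (vanIdeal T).IsPrime) :
    IsIrreducible T := by
  refine ⟨?_, isPreirreducible_iff_isClosed_union_isClosed.mpr fun Z W hZ hW hTZW => ?_⟩
  · by_contra h
    rw [Set.not_nonempty_iff_eq_empty] at h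
    exact hT.ne_top ((Ideal.eq_top_iff_one _).mpr (by simp [mem_vanIdeal, h]))
  · by_contra! hc
    obtain ⟨h1, h2⟩ := hc
    obtain ⟨μ, hμ, hμZ⟩ := Set.not_subset.mp h1
    obtain ⟨ν, hν, hνW⟩ := Set.not_subset.mp h2
    rw [← hZ.closure_eq, mem_closure_iff_vanIdeal] at hμZ
    rw [← hW.closure_eq, mem_closure_iff_vanIdeal] at hνW
    push Not at hμZ hνW
    obtain ⟨P, hP, hP'⟩ := hμZ
    obtain ⟨Q, hQ, hQ'⟩ := hνW
    have hPQ : P * Q ∈ vanIdeal T := fun κ hκ => by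
      rw [map_mul]
      rcases hTZW hκ with h | h
      · rw [hP κ h, zero_mul]
      · rw [hQ κ h, mul_zero]
    rcases hT.mem_or_mem hPQ with h | h
    · exact hP' (h μ hμ)
    · exact hQ' (h ν hν)

/-- The dimension of a set of laws is at most that of its Zariski closure, computed in its
coordinate ring. -/
theorem topologicalKrullDim_le_ringKrullDim (T : Set (LieLaw n)) :
    topologicalKrullDim T ≤ ringKrullDim (MvPolynomial (StructIdx n) ℂ ⧸ vanIdeal T) := by
  rw [ringKrullDim_quotient, ← Order.krullDim_orderDual]
  let f : TopologicalSpace.IrreducibleCloseds T →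
      PrimeSpectrum.zeroLocus (R := MvPolynomial (StructIdx n) ℂ) (vanIdeal T) := fun Z =>
    ⟨⟨vanIdeal (Subtype.val '' Z.carrier),
      vanIdeal_isPrime (isIrreducible_image_val.mpr Z.isIrreducible')⟩,
      vanIdeal_anti (by rintro _ ⟨x, -, rfl⟩; exact x.2)⟩
  have hle : ∀ Z W, f W ≤ f Z → Z ≤ W := fun Z W h x hx => by
    have hcl : closure W.carrier = W.carrier := W.isClosed'.closure_eq
    change x ∈ W.carrier
    rw [← hcl, closure_subtype, mem_closure_iff_vanIdeal]
    exact fun P hP => (show vanIdeal _ ≤ vanIdeal _ from h) hP _ ⟨x, hx, rfl⟩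
  refine Order.krullDim_le_of_strictMono (fun Z => OrderDual.toDual (f Z)) fun Z W h => ?_
  refine lt_of_le_not_ge (OrderDual.toDual_le_toDual.mpr ?_) fun h' => ?_
  · exact vanIdeal_anti (Set.image_mono h.le)
  · exact h.not_ge (hle W Z h')

/-- A strictly decreasing sequence of prime ideals of subsets of `T` bounds the dimension of `T`
from below. -/
theorem le_topologicalKrullDim {T : Set (LieLaw n)} {r : ℕ} (c : Fin (r + 1) → Set (LieLaw n))
    (hc : ∀ i, c i ⊆ T) (hprime : ∀ i, (vanIdeal (c i)).IsPrime)
    (hanti : StrictAnti fun i => vanIdeal (c i)) : (r : WithBot ℕ∞) ≤ topologicalKrullDim T := by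
  have him : ∀ i, Subtype.val '' (Subtype.val ⁻¹' c i : Set T) = c i := fun i => by
    rw [Subtype.image_preimage_coe, Set.inter_eq_right.mpr (hc i)]
  let Z : Fin (r + 1) → TopologicalSpace.IrreducibleCloseds T := fun i =>
    ⟨closure (Subtype.val ⁻¹' c i), (isIrreducible_image_val.mp (by
      rw [him]; exact isIrreducible_of_vanIdeal_isPrime (hprime i))).closure, isClosed_closure⟩
  have hmem : ∀ i (x : T), x ∈ Z i ↔ ∀ P ∈ vanIdeal (c i), MvPolynomial.eval x.1.coords P = 0 :=
    fun i x => by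
      change x ∈ closure _ ↔ _
      rw [closure_subtype, him, mem_closure_iff_vanIdeal]
  have hle : ∀ i j, Z i ≤ Z j ↔ vanIdeal (c j) ≤ vanIdeal (c i) := fun i j => by
    constructor
    · intro h P hP μ hμ
      exact (hmem j ⟨μ, hc i hμ⟩).mp (h ((hmem i _).mpr fun Q hQ => hQ μ hμ)) P hP
    · intro h x hx
      exact (hmem j x).mpr fun P hP => (hmem i x).mp hx P (h hP)
  have hZ : StrictMono Z := fun i j hij => by
    rw [lt_iff_le_not_ge, hle, hle]
    exact ⟨(hanti hij).le, (hanti hij).not_ge⟩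
  exact Order.LTSeries.length_le_krullDim (LTSeries.mk r Z hZ)

/-! ### Isomorphism is an equivalence relation -/

theorem Isomorphic.symm {μ ν : LieLaw n} (h : Isomorphic μ ν) : Isomorphic ν μ := by
  obtain ⟨f, rfl⟩ := h
  refine ⟨f.symm, LieLaw.ext (LinearMap.ext fun X => LinearMap.ext fun Y => ?_)⟩
  simp [act_apply]

theorem Isomorphic.trans {μ ν κ : LieLaw n} (h : Isomorphic μ ν) (h' : Isomorphic ν κ) :
    Isomorphic μ κ := by
  obtain ⟨f, rfl⟩ := h
  obtain ⟨g, rfl⟩ := h'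
  refine ⟨g.trans f, LieLaw.ext (LinearMap.ext fun X => LinearMap.ext fun Y => ?_)⟩
  simp [act_apply]

theorem orbit_eq_of_isomorphic {μ ν : LieLaw n} (h : Isomorphic μ ν) : orbit μ = orbit ν :=
  Set.ext fun _ => ⟨fun h' => h.symm.trans h', fun h' => h.trans h'⟩

/-! ### Lower semicontinuity of ranks -/

/-- The rank of a linear map whose entries are polynomials in the structure constants cannot drop
where a suitable polynomial, a minor that does not vanish at `μ₀`, is nonzero. -/
theorem exists_polynomial_finrank_range_le {V ι : Type*} [AddCommGroup V] [Module ℂ V]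
    [FiniteDimensional ℂ V] [Fintype ι] (δ : LieLaw n → V →ₗ[ℂ] (ι → ℂ))
    (p : V → ι → MvPolynomial (StructIdx n) ℂ)
    (hp : ∀ μ v x, MvPolynomial.eval μ.coords (p v x) = δ μ v x) (μ₀ : LieLaw n) :
    ∃ P : MvPolynomial (StructIdx n) ℂ, MvPolynomial.eval μ₀.coords P ≠ 0 ∧
      ∀ μ : LieLaw n, MvPolynomial.eval μ.coords P ≠ 0 →
        Module.finrank ℂ (LinearMap.range (δ μ₀)) ≤ Module.finrank ℂ (LinearMap.range (δ μ)) := by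
  let b := Module.finBasis ℂ (LinearMap.range (δ μ₀))
  choose v hv using fun i => (b i).2
  have hli : LinearIndependent ℂ fun i => δ μ₀ (v i) := by
    have h := b.linearIndependent.map' (LinearMap.range (δ μ₀)).subtype (Submodule.ker_subtype _)
    have heq : (fun i => δ μ₀ (v i)) = (LinearMap.range (δ μ₀)).subtype ∘ b := funext hv
    rwa [heq]
  obtain ⟨Q, hQ⟩ := hli.exists_dual_family
  let A := Matrix.of fun i j => ∑ x, MvPolynomial.C (Q i x) * p (v j) x
  have hA : ∀ μ : LieLaw n, MvPolynomial.eval μ.coords A.det =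
      (Matrix.of fun i j => ∑ x, Q i x * δ μ (v j) x).det := fun μ => by
    rw [RingHom.map_det]
    congr 1
    ext i j
    simp [A, hp]
  refine ⟨A.det, ?_, fun μ hμ => ?_⟩
  · rw [hA]
    have : (Matrix.of fun i j => ∑ x, Q i x * δ μ₀ (v j) x) = 1 := by
      ext i j
      simp [hQ, Matrix.one_apply]
    simp [this]
  · rw [hA] at hμ
    have hli' : LinearIndependent ℂ fun i => δ μ (v i) := by
      rw [Fintype.linearIndependent_iff]
      intro g hg
      refine congrFun (Matrix.eq_zero_of_mulVec_eq_zero hμ (funext fun i => ?_))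
      simp only [Matrix.mulVec, dotProduct, Matrix.of_apply, Finset.sum_mul, Pi.zero_apply]
      rw [Finset.sum_comm]
      refine Finset.sum_eq_zero fun x _ => ?_
      have := congrFun hg x
      simp only [Finset.sum_apply, Pi.smul_apply, smul_eq_mul, Pi.zero_apply] at this
      rw [← mul_zero (Q i x), ← this, Finset.mul_sum]
      exact Finset.sum_congr rfl fun j _ => by ring
    have hli2 : LinearIndependent ℂ
        fun i => (⟨δ μ (v i), v i, rfl⟩ : LinearMap.range (δ μ)) :=
      LinearIndependent.of_comp (LinearMap.range (δ μ)).subtype hli'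
    simpa using hli2.fintype_card_le_finrank

/-- The entries of a bilinear map on the standard basis. -/
def entries : ((Fin n → ℂ) →ₗ[ℂ] (Fin n → ℂ) →ₗ[ℂ] (Fin n → ℂ)) →ₗ[ℂ]
    (Fin n × Fin n × Fin n → ℂ) where
  toFun B x := B (Pi.single x.1 1) (Pi.single x.2.1 1) x.2.2
  map_add' _ _ := rfl
  map_smul' _ _ := rfl

theorem entries_injective : Function.Injective (entries (n := n)) := fun _ _ h =>
  LinearMap.pi_ext' fun i => LinearMap.ext_ring (LinearMap.pi_ext' fun j =>
    LinearMap.ext_ring (funext fun k => congrFun h (i, j, k)))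

theorem toFun_apply_eq_sum (μ : LieLaw n) (v w : Fin n → ℂ) (s : Fin n) :
    μ.toFun v w s = ∑ a, ∑ b, μ.structConst a b s * v a * w b := by
  rw [bilin_expand]
  refine Finset.sum_congr rfl fun a _ => ?_
  have := bilin_expand μ.toFun.flip w (Pi.single a 1) s
  simp only [LinearMap.flip_apply] at this
  rw [this, Finset.mul_sum]
  exact Finset.sum_congr rfl fun b _ => by rw [structConst]; ring

theorem eval_sum_structVar (μ : LieLaw n) (v w : Fin n → ℂ) (s : Fin n) :
    MvPolynomial.eval μ.coords
      (∑ a, ∑ b, structVar a b s * MvPolynomial.C (v a) * MvPolynomial.C (w b)) =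
      μ.toFun v w s := by
  simp [toFun_apply_eq_sum, eval_structVar]

/-- The rank of `δ⁰`: the dimension of the space of inner derivations. -/
noncomputable def rank0 (μ : LieLaw n) : ℕ := Module.finrank ℂ (LinearMap.range (delta0 μ))

/-- The rank of `δ¹`: the dimension of the tangent space of the orbit of `μ`. -/
noncomputable def rank1 (μ : LieLaw n) : ℕ := Module.finrank ℂ (LinearMap.range (delta1 μ))

theorem exists_polynomial_rank1_le (μ₀ : LieLaw n) :
    ∃ P : MvPolynomial (StructIdx n) ℂ, MvPolynomial.eval μ₀.coords P ≠ 0 ∧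
      ∀ μ : LieLaw n, MvPolynomial.eval μ.coords P ≠ 0 → rank1 μ₀ ≤ rank1 μ := by
  have := exists_polynomial_finrank_range_le (fun μ : LieLaw n => entries ∘ₗ delta1 μ)
    (fun g x => -(∑ l, structVar x.1 x.2.1 l * MvPolynomial.C (g (Pi.single l 1) x.2.2))
      + (∑ a, ∑ b, structVar a b x.2.2 * MvPolynomial.C (g (Pi.single x.1 1) a) *
          MvPolynomial.C ((Pi.single x.2.1 1 : Fin n → ℂ) b))
      + (∑ a, ∑ b, structVar a b x.2.2 * MvPolynomial.C ((Pi.single x.1 1 : Fin n → ℂ) a) *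
          MvPolynomial.C (g (Pi.single x.2.1 1) b)))
    (fun μ g x => ?_) μ₀
  · simpa only [rank0, rank1, finrank_range_comp_of_injective _ entries_injective] using this
  · rw [map_add, map_add, eval_sum_structVar, eval_sum_structVar]
    change _ = delta1 μ g _ _ _
    rw [delta1_apply]
    simp only [Pi.add_apply, Pi.neg_apply, map_neg, map_sum, map_mul, eval_structVar,
      MvPolynomial.eval_C]
    congr 3
    conv_rhs => rw [LinearMap.pi_apply_eq_sum_univ g (μ.toFun _ _)]
    rw [Finset.sum_apply]
    refine Finset.sum_congr rfl fun c _ => ?_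
    have hc : (fun j => if c = j then (1 : ℂ) else 0) = Pi.single c 1 := by
      ext j
      simp [Pi.single_apply, eq_comm]
    rw [hc]
    rfl

theorem exists_polynomial_rank0_le (μ₀ : LieLaw n) :
    ∃ P : MvPolynomial (StructIdx n) ℂ, MvPolynomial.eval μ₀.coords P ≠ 0 ∧
      ∀ μ : LieLaw n, MvPolynomial.eval μ.coords P ≠ 0 → rank0 μ₀ ≤ rank0 μ := by
  let E : ((Fin n → ℂ) →ₗ[ℂ] (Fin n → ℂ)) →ₗ[ℂ] (Fin n × Fin n → ℂ) :=
    { toFun := fun g x => g (Pi.single x.1 1) x.2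
      map_add' := fun _ _ => rfl
      map_smul' := fun _ _ => rfl }
  have hE : Function.Injective E := fun _ _ h =>
    LinearMap.pi_ext' fun i => LinearMap.ext_ring (funext fun k => congrFun h (i, k))
  have := exists_polynomial_finrank_range_le (fun μ : LieLaw n => E ∘ₗ delta0 μ)
    (fun v x => ∑ a, ∑ b, structVar a b x.2 * MvPolynomial.C ((Pi.single x.1 1 : Fin n → ℂ) a) *
          MvPolynomial.C (v b))
    (fun μ v x => eval_sum_structVar μ _ _ _) μ₀
  simpa only [rank0, rank1, finrank_range_comp_of_injective _ hE] using this

theorem rank0_add_finrank_H0 (μ : LieLaw n) : rank0 μ + Module.finrank ℂ (H0 μ) = n := by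
  simpa [rank0] using LinearMap.finrank_range_add_finrank_ker (delta0 μ)

theorem rank1_add_finrank_ker (μ : LieLaw n) :
    rank1 μ + Module.finrank ℂ (LinearMap.ker (delta1 μ)) = n ^ 2 := by
  have := LinearMap.finrank_range_add_finrank_ker (delta1 μ)
  rw [Module.finrank_linearMap, Module.finrank_fin_fun] at this
  rw [sq]
  exact this

/-- Inner derivations are derivations. -/
theorem rank0_add_rank1_le (μ : LieLaw n) : rank0 μ + rank1 μ ≤ n ^ 2 := by
  have := Submodule.finrank_mono (range_delta0_le_ker_delta1 μ)
  have := rank1_add_finrank_ker μ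
  unfold rank0
  omega

theorem rank0_add_rank1_of_H1 (μ : LieLaw n) (h : Subsingleton (H1 μ)) :
    rank0 μ + rank1 μ = n ^ 2 := by
  have h1 := Submodule.Quotient.subsingleton_iff.mp h
  have h2 : LinearMap.ker (delta1 μ) ≤ LinearMap.range (delta0 μ) :=
    Submodule.submoduleOf_eq_top.mp h1
  have h3 := Submodule.finrank_mono h2
  have := rank0_add_rank1_le μ
  have := rank1_add_finrank_ker μ
  unfold rank0 at *
  omega

/-- Near a law with `H¹ = 0` neither rank decreases, while their sum is at most its value `n²` at
that law: the ranks are constant. -/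
theorem exists_polynomial_rank1_eq (μ₀ : LieLaw n) (h : Subsingleton (H1 μ₀)) :
    ∃ P : MvPolynomial (StructIdx n) ℂ, MvPolynomial.eval μ₀.coords P ≠ 0 ∧
      ∀ μ : LieLaw n, MvPolynomial.eval μ.coords P ≠ 0 → rank1 μ = rank1 μ₀ := by
  obtain ⟨P, hP, hP'⟩ := exists_polynomial_rank0_le μ₀
  obtain ⟨Q, hQ, hQ'⟩ := exists_polynomial_rank1_le μ₀
  refine ⟨P * Q, by rw [map_mul]; exact mul_ne_zero hP hQ, fun μ hμ => ?_⟩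
  rw [map_mul] at hμ
  have := hP' μ (left_ne_zero_of_mul hμ)
  have := hQ' μ (right_ne_zero_of_mul hμ)
  have := rank0_add_rank1_le μ
  have := rank0_add_rank1_of_H1 μ₀ h
  omega

/-! ### Laws transported by matrices over a `ℂ`-algebra -/

section Transport

variable {R R' : Type*} [CommRing R] [Algebra ℂ R] [CommRing R'] [Algebra ℂ R']

/-- The bracket of `μ` extended to `Rⁿ`, for a commutative `ℂ`-algebra `R`. -/
def bracket (μ : LieLaw n) (v w : Fin n → R) : Fin n → R :=
  fun s => ∑ a, ∑ b, algebraMap ℂ R (μ.structConst a b s) * v a * w b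

theorem bracket_add_left (μ : LieLaw n) (v v' w : Fin n → R) :
    bracket μ (v + v') w = bracket μ v w + bracket μ v' w := by
  ext s
  simp only [bracket, Pi.add_apply, ← Finset.sum_add_distrib]
  exact Finset.sum_congr rfl fun a _ => Finset.sum_congr rfl fun b _ => by ring

theorem structConst_swap (μ : LieLaw n) (i j k : Fin n) :
    μ.structConst i j k = -μ.structConst j i k := by
  rw [structConst, μ.skew]
  rfl

theorem bracket_swap (μ : LieLaw n) (v w : Fin n → R) : bracket μ v w = -bracket μ w v := by
  ext s
  simp only [bracket, Pi.neg_apply]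
  rw [Finset.sum_comm, ← Finset.sum_neg_distrib]
  refine Finset.sum_congr rfl fun a _ => ?_
  rw [← Finset.sum_neg_distrib]
  refine Finset.sum_congr rfl fun b _ => ?_
  rw [structConst_swap, map_neg]
  ring

theorem bracket_self (μ : LieLaw n) (v : Fin n → R) : bracket μ v v = 0 := by
  have h := bracket_swap μ v v
  have h2 : (2 : ℂ) • bracket μ v v = 0 := by
    rw [two_smul]
    nth_rewrite 1 [h]
    exact neg_add_cancel _
  calc bracket μ v v = (2⁻¹ : ℂ) • (2 : ℂ) • bracket μ v v := by
        rw [smul_smul, inv_mul_cancel₀ two_ne_zero, one_smul]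
    _ = 0 := by rw [h2, smul_zero]

theorem bracket_sum_smul_left {ι : Type*} (s : Finset ι) (μ : LieLaw n) (c : ι → R)
    (v : ι → Fin n → R) (w : Fin n → R) :
    bracket μ (∑ i ∈ s, c i • v i) w = ∑ i ∈ s, c i • bracket μ (v i) w := by
  let f : (Fin n → R) →ₗ[R] (Fin n → R) :=
    { toFun := fun v => bracket μ v w
      map_add' := fun v v' => bracket_add_left μ v v' w
      map_smul' := fun r v => by
        ext s
        simp only [bracket, Pi.smul_apply, smul_eq_mul, RingHom.id_apply, Finset.mul_sum]
        exact Finset.sum_congr rfl fun a _ => Finset.sum_congr rfl fun b _ => by ring }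
  change f _ = ∑ i ∈ s, c i • f (v i)
  simp

theorem bracket_sum_smul_right {ι : Type*} (s : Finset ι) (μ : LieLaw n) (c : ι → R)
    (v : ι → Fin n → R) (w : Fin n → R) :
    bracket μ w (∑ i ∈ s, c i • v i) = ∑ i ∈ s, c i • bracket μ w (v i) := by
  rw [bracket_swap, bracket_sum_smul_left, ← Finset.sum_neg_distrib]
  exact Finset.sum_congr rfl fun i _ => by rw [← smul_neg, ← bracket_swap]

theorem map_bracket (μ : LieLaw n) (e : R →ₐ[ℂ] R') (v w : Fin n → R) :
    e ∘ bracket μ v w = bracket μ (e ∘ v) (e ∘ w) := by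
  ext s
  simp [bracket]

theorem bracket_complex (μ : LieLaw n) (v w : Fin n → ℂ) : bracket μ v w = μ.toFun v w := by
  ext s
  rw [toFun_apply_eq_sum]
  rfl

theorem derivation_bracket (μ : LieLaw n) (d : Derivation ℂ R R) (v w : Fin n → R) :
    d ∘ bracket μ v w = bracket μ (d ∘ v) w + bracket μ v (d ∘ w) := by
  ext s
  simp only [bracket, Function.comp_apply, map_sum, Derivation.leibniz, Pi.add_apply,
    Derivation.map_algebraMap, smul_eq_mul, ← Finset.sum_add_distrib]
  exact Finset.sum_congr rfl fun a _ => Finset.sum_congr rfl fun b _ => by ring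

/-- The structure constants of `μ` transported by an invertible matrix `X` over `R`:
the vector `X⁻¹ [X eᵢ, X eⱼ]`. -/
def transported (μ : LieLaw n) (X : GL (Fin n) R) (i j : Fin n) : Fin n → R :=
  (X⁻¹).val.mulVec (bracket μ (X.val.col i) (X.val.col j))

/-- The independent structure constants of the transported law. -/
def transportedCoords (μ : LieLaw n) (X : GL (Fin n) R) : StructIdx n → R :=
  fun p => transported μ X p.1.1.1 p.1.1.2 p.2

theorem mulVec_transported (μ : LieLaw n) (X : GL (Fin n) R) (i j : Fin n) :
    X.val.mulVec (transported μ X i j) = bracket μ (X.val.col i) (X.val.col j) := by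
  rw [transported, Matrix.mulVec_mulVec, ← Units.val_mul, mul_inv_cancel, Units.val_one,
    Matrix.one_mulVec]

theorem aeval_transportedCoords_structVar (μ : LieLaw n) (X : GL (Fin n) R) (i j k : Fin n) :
    MvPolynomial.aeval (transportedCoords μ X) (structVar i j k) = transported μ X i j k := by
  unfold structVar
  split_ifs with h1 h2
  · simp [transportedCoords]
  · simp only [map_neg, MvPolynomial.aeval_X, transportedCoords, transported]
    rw [bracket_swap μ (X.val.col i), Matrix.mulVec_neg]
    rfl
  · obtain rfl : i = j := le_antisymm (not_lt.mp h2) (not_lt.mp h1)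
    simp [transported, bracket_self]

theorem map_transported (μ : LieLaw n) (e : R →ₐ[ℂ] R') (X : GL (Fin n) R) (i j : Fin n) :
    e ∘ transported μ X i j =
      transported μ (Matrix.GeneralLinearGroup.map (e : R →+* R') X) i j := by
  have h1 : (Matrix.GeneralLinearGroup.map (e : R →+* R') X).val = X.val.map e := rfl
  have h2 : (Matrix.GeneralLinearGroup.map (e : R →+* R') X)⁻¹.val = (X⁻¹).val.map e := rfl
  rw [transported, transported, h1, h2]
  have hc : ∀ i, (X.val.map e).col i = e ∘ X.val.col i := fun _ => rfl
  rw [hc, hc, ← map_bracket]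
  ext k
  exact RingHom.map_mulVec (e : R →+* R') _ _ k

theorem map_transportedCoords (μ : LieLaw n) (e : R →ₐ[ℂ] R') (X : GL (Fin n) R) :
    e ∘ transportedCoords μ X =
      transportedCoords μ (Matrix.GeneralLinearGroup.map (e : R →+* R') X) :=
  funext fun p => congrFun (map_transported μ e X p.1.1.1 p.1.1.2) p.2

/-- The derivative `[V eᵢ, X eⱼ] + [X eᵢ, V eⱼ] - V X⁻¹ [X eᵢ, X eⱼ]` of the transported law in the
direction `V`, multiplied by `X`. -/
def variation (μ : LieLaw n) (X : GL (Fin n) R) (V : Matrix (Fin n) (Fin n) R) (i j : Fin n) :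
    Fin n → R :=
  bracket μ (V.col i) (X.val.col j) + bracket μ (X.val.col i) (V.col j)
    - V.mulVec (transported μ X i j)

/-- A derivation `d` of `R` acts on the transported structure constants through the matrix `dX`. -/
theorem mulVec_derivation_transported (μ : LieLaw n) (d : Derivation ℂ R R) (X : GL (Fin n) R)
    (i j : Fin n) :
    X.val.mulVec (d ∘ transported μ X i j) = variation μ X (X.val.map d) i j := by
  have h := congrArg (d ∘ ·) (mulVec_transported μ X i j)
  simp only [derivation_bracket] at h
  have hd : d ∘ X.val.mulVec (transported μ X i j) =
      X.val.mulVec (d ∘ transported μ X i j) + (X.val.map d).mulVec (transported μ X i j) := by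
    ext k
    simp only [Matrix.mulVec, dotProduct, Function.comp_apply, map_sum, Derivation.leibniz,
      Pi.add_apply, smul_eq_mul, Matrix.map_apply, ← Finset.sum_add_distrib]
    exact Finset.sum_congr rfl fun a _ => by ring
  rw [hd] at h
  rw [variation, eq_sub_iff_add_eq, h]
  rfl

theorem variation_sum_smul {ι : Type*} (s : Finset ι) (μ : LieLaw n) (X : GL (Fin n) R) (c : ι → R)
    (V : ι → Matrix (Fin n) (Fin n) R) (i j : Fin n) :
    variation μ X (∑ a ∈ s, c a • V a) i j = ∑ a ∈ s, c a • variation μ X (V a) i j := by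
  have hc : ∀ i, (∑ a ∈ s, c a • V a).col i = ∑ a ∈ s, c a • (V a).col i := fun i => by
    ext k
    simp [Matrix.sum_apply]
  rw [variation, hc, hc, bracket_sum_smul_left, bracket_sum_smul_right, Matrix.sum_mulVec,
    ← Finset.sum_add_distrib, ← Finset.sum_sub_distrib]
  refine Finset.sum_congr rfl fun a _ => ?_
  rw [Matrix.smul_mulVec, variation, smul_sub, smul_add]

theorem map_variation (μ : LieLaw n) (e : R →ₐ[ℂ] R') (X : GL (Fin n) R)
    (V : Matrix (Fin n) (Fin n) R) (i j : Fin n) :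
    e ∘ variation μ X V i j =
      variation μ (Matrix.GeneralLinearGroup.map (e : R →+* R') X) (V.map e) i j := by
  have h1 : ∀ i, (Matrix.GeneralLinearGroup.map (e : R →+* R') X).val.col i = e ∘ X.val.col i :=
    fun _ => rfl
  have h2 : ∀ i, (V.map e).col i = e ∘ V.col i := fun _ => rfl
  rw [variation, variation, h1, h1, h2, h2, ← map_bracket, ← map_bracket, ← map_transported]
  ext k
  have := RingHom.map_mulVec (e : R →+* R') V (transported μ X i j) k
  simp only [Function.comp_apply, Pi.sub_apply, Pi.add_apply, map_sub, map_add]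
  congr 1

/-- At the identity the variation is the coboundary `δ¹`. -/
theorem variation_one (μ : LieLaw n) (V : Matrix (Fin n) (Fin n) ℂ) (i j : Fin n) :
    variation μ 1 V i j =
      delta1 μ (Matrix.toLin' V) (Pi.single i 1) (Pi.single j 1) := by
  have h1 : ∀ i, (1 : GL (Fin n) ℂ).val.col i = Pi.single i 1 := fun i => by
    ext k
    simp [Matrix.one_apply, Pi.single_apply]
  have h2 : transported μ (1 : GL (Fin n) ℂ) i j = μ.toFun (Pi.single i 1) (Pi.single j 1) := by
    rw [transported, inv_one, Units.val_one, Matrix.one_mulVec, ← Units.val_one, h1, h1,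
      bracket_complex]
  rw [variation, h1, h1, h2, bracket_complex, bracket_complex, delta1_apply]
  simp only [Matrix.toLin'_apply, Matrix.mulVec_single_one]
  abel

end Transport

/-- The law transported by an invertible complex matrix. -/
def transport (μ : LieLaw n) (X : GL (Fin n) ℂ) : LieLaw n :=
  act (Matrix.toLin'OfInv (M := (X⁻¹).val) (M' := X.val) (by simp) (by simp)) μ

theorem transport_mem_orbit (μ : LieLaw n) (X : GL (Fin n) ℂ) : transport μ X ∈ orbit μ :=
  ⟨_, rfl⟩

theorem transport_apply (μ : LieLaw n) (X : GL (Fin n) ℂ) (v w : Fin n → ℂ) :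
    (transport μ X).toFun v w =
      (X⁻¹).val.mulVec (μ.toFun (X.val.mulVec v) (X.val.mulVec w)) := rfl

theorem coords_transport (μ : LieLaw n) (X : GL (Fin n) ℂ) :
    (transport μ X).coords = transportedCoords μ X := by
  ext p
  simp only [coords, structConst, transport_apply, transportedCoords, transported,
    bracket_complex, Matrix.mulVec_single_one]

theorem exists_transport_eq {μ ν : LieLaw n} (h : ν ∈ orbit μ) :
    ∃ X : GL (Fin n) ℂ, transport μ X = ν := by
  obtain ⟨f, rfl⟩ := h
  refine ⟨⟨LinearMap.toMatrix' f.toLinearMap, LinearMap.toMatrix' f.symm.toLinearMap, ?_, ?_⟩, ?_⟩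
  · rw [← LinearMap.toMatrix'_comp]; simp
  · rw [← LinearMap.toMatrix'_comp]; simp
  · refine LieLaw.ext (LinearMap.ext fun X => LinearMap.ext fun Y => ?_)
    rw [transport_apply, act_apply]
    change (LinearMap.toMatrix' f.symm.toLinearMap).mulVec (μ.toFun
      ((LinearMap.toMatrix' f.toLinearMap).mulVec X)
      ((LinearMap.toMatrix' f.toLinearMap).mulVec Y)) = _
    simp only [LinearMap.toMatrix'_mulVec, LinearEquiv.coe_coe]

/-! ### Families of laws and the function field of their parameters -/

/-- The laws obtained from `μ` by specializing an invertible matrix `X` over a `ℂ`-algebra `B` at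
the rational points of `B`. -/
def family {B : Type*} [CommRing B] [Algebra ℂ B] (μ : LieLaw n) (X : GL (Fin n) B) :
    Set (LieLaw n) :=
  Set.range fun e : B →ₐ[ℂ] ℂ => transport μ (Matrix.GeneralLinearGroup.map (e : B →+* ℂ) X)

theorem family_subset_orbit {B : Type*} [CommRing B] [Algebra ℂ B] (μ : LieLaw n)
    (X : GL (Fin n) B) : family μ X ⊆ orbit μ := by
  rintro _ ⟨e, rfl⟩
  exact transport_mem_orbit μ _

theorem eval_coords_transport_map {B : Type*} [CommRing B] [Algebra ℂ B] (μ : LieLaw n)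
    (X : GL (Fin n) B) (e : B →ₐ[ℂ] ℂ) (P : MvPolynomial (StructIdx n) ℂ) :
    MvPolynomial.eval (transport μ (Matrix.GeneralLinearGroup.map (e : B →+* ℂ) X)).coords P =
      e (MvPolynomial.aeval (transportedCoords μ X) P) := by
  rw [coords_transport, ← map_transportedCoords]
  change MvPolynomial.aeval (e ∘ transportedCoords μ X) P = _
  exact (MvPolynomial.comp_aeval_apply (transportedCoords μ X) e P).symm

/-- By the Nullstellensatz, the polynomial relations between the laws of a family are those
satisfied by its generic member. -/
theorem vanIdeal_family {B : Type*} [CommRing B] [IsDomain B] [Algebra ℂ B]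
    [Algebra.FiniteType ℂ B] (μ : LieLaw n) (X : GL (Fin n) B) :
    vanIdeal (family μ X) = RingHom.ker (MvPolynomial.aeval (R := ℂ) (transportedCoords μ X)) := by
  ext P
  rw [mem_vanIdeal, RingHom.mem_ker]
  constructor
  · intro h
    by_contra h0
    obtain ⟨e, he⟩ := exists_algHom_apply_ne_zero (k := ℂ) h0
    exact he (by rw [← eval_coords_transport_map]; exact h _ ⟨e, rfl⟩)
  · rintro h _ ⟨e, rfl⟩
    simp only [eval_coords_transport_map]
    rw [h, map_zero]

section Param

variable {σ : Type} (F : Matrix (Fin n) (Fin n) (MvPolynomial σ ℂ))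

/-- The coordinate ring of the open subset of the affine space where the polynomial matrix `F` is
invertible. -/
abbrev ParamRing : Type := Localization.Away F.det

/-- The matrix `F` over the coordinate ring of the open subset where it is invertible. -/
noncomputable def paramMatrix : GL (Fin n) (ParamRing F) :=
  Matrix.GeneralLinearGroup.mk'' (F.map (algebraMap _ (ParamRing F))) (by
    rw [← RingHom.mapMatrix_apply, ← RingHom.map_det]
    exact IsLocalization.Away.algebraMap_isUnit _)

instance [Finite σ] : Algebra.FiniteType ℂ (ParamRing F) := by
  have : Algebra.FiniteType (MvPolynomial σ ℂ) (ParamRing F) :=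
    IsLocalization.finiteType_of_monoid_fg (Submonoid.powers F.det) _
  exact Algebra.FiniteType.trans (S := MvPolynomial σ ℂ) inferInstance inferInstance

variable {F} in
theorem isDomain_paramRing (hF : F.det ≠ 0) : IsDomain (ParamRing F) :=
  IsLocalization.isDomain_localization (powers_le_nonZeroDivisors_of_noZeroDivisors hF)

/-- Evaluation at a point where `F` is invertible. -/
noncomputable def evalParam (t : σ → ℂ) (ht : MvPolynomial.eval t F.det ≠ 0) :
    ParamRing F →ₐ[ℂ] ℂ :=
  IsLocalization.liftAlgHom (M := Submonoid.powers F.det) (f := MvPolynomial.aeval t) (by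
    rintro ⟨_, k, rfl⟩
    simp only [map_pow]
    exact (IsUnit.mk0 _ ht).pow k)

theorem evalParam_algebraMap (t : σ → ℂ) (ht : MvPolynomial.eval t F.det ≠ 0)
    (P : MvPolynomial σ ℂ) : evalParam F t ht (algebraMap _ _ P) = MvPolynomial.eval t P := by
  rw [evalParam, IsLocalization.liftAlgHom_apply]
  exact IsLocalization.lift_eq _ _

theorem map_evalParam_paramMatrix (t : σ → ℂ) (ht : MvPolynomial.eval t F.det ≠ 0) :
    (Matrix.GeneralLinearGroup.map (evalParam F t ht : ParamRing F →+* ℂ) (paramMatrix F)).val =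
      F.map (MvPolynomial.eval t) := by
  ext i j
  exact evalParam_algebraMap F t ht (F i j)

/-- Every rational point of the coordinate ring is an evaluation. -/
theorem exists_eq_evalParam (e : ParamRing F →ₐ[ℂ] ℂ) :
    ∃ (t : σ → ℂ) (ht : MvPolynomial.eval t F.det ≠ 0), e = evalParam F t ht := by
  let t : σ → ℂ := fun c => e (algebraMap (MvPolynomial σ ℂ) (ParamRing F) (MvPolynomial.X c))
  have he : ∀ P, e (algebraMap _ _ P) = MvPolynomial.eval t P := fun P => by
    have : (e.comp (IsScalarTower.toAlgHom ℂ (MvPolynomial σ ℂ) (ParamRing F))) =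
        MvPolynomial.aeval t := by
      ext c
      simp [t]
    exact DFunLike.congr_fun this P
  have ht : MvPolynomial.eval t F.det ≠ 0 := by
    rw [← he]
    exact ((IsLocalization.Away.algebraMap_isUnit (S := ParamRing F) F.det).map e).ne_zero
  refine ⟨t, ht, IsLocalization.algHom_ext (Submonoid.powers F.det) (AlgHom.ext fun P => ?_)⟩
  exact (he P).trans (evalParam_algebraMap F t ht P).symm

/-- The function field of the affine space, as fraction field of the coordinate ring. -/
abbrev ParamField : Type := FractionRing (ParamRing F)

instance [IsDomain (ParamRing F)] :
    Algebra.FormallyEtale (MvPolynomial σ ℂ) (ParamField F) := by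
  have : Algebra.FormallyEtale (MvPolynomial σ ℂ) (ParamRing F) :=
    Algebra.FormallyEtale.of_isLocalization (Submonoid.powers F.det)
  have : Algebra.FormallyEtale (ParamRing F) (ParamField F) :=
    Algebra.FormallyEtale.of_isLocalization (nonZeroDivisors (ParamRing F))
  exact Algebra.FormallyEtale.comp _ (ParamRing F) _

instance [Finite σ] : Algebra.EssFiniteType ℂ (ParamField F) := by
  have : Algebra.EssFiniteType (ParamRing F) (ParamField F) :=
    Algebra.EssFiniteType.of_isLocalization _ (nonZeroDivisors (ParamRing F))
  exact Algebra.EssFiniteType.comp _ (ParamRing F) _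

variable {F} in
theorem trdeg_paramField [Finite σ] (hF : F.det ≠ 0) [IsDomain (ParamRing F)] :
    Algebra.trdeg ℂ (ParamField F) = Nat.card σ := by
  have h1 : Algebra.IsAlgebraic (MvPolynomial σ ℂ) (ParamRing F) :=
    IsLocalization.isAlgebraic _ (Submonoid.powers F.det)
  have h2 : Algebra.IsAlgebraic (ParamRing F) (ParamField F) :=
    IsLocalization.isAlgebraic _ (nonZeroDivisors (ParamRing F))
  have h3 : Algebra.IsAlgebraic (MvPolynomial σ ℂ) (ParamField F) :=
    Algebra.IsAlgebraic.trans _ (ParamRing F) _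
  have h4 : FaithfulSMul (MvPolynomial σ ℂ) (ParamField F) := by
    rw [faithfulSMul_iff_algebraMap_injective,
      IsScalarTower.algebraMap_eq _ (ParamRing F) (ParamField F)]
    exact (IsFractionRing.injective (ParamRing F) (ParamField F)).comp
      (IsLocalization.injective (ParamRing F) (powers_le_nonZeroDivisors_of_noZeroDivisors hF))
  rw [← trdeg_add_eq ℂ (MvPolynomial σ ℂ) (A := ParamField F), MvPolynomial.trdeg_of_isDomain,
    trdeg_eq_zero, add_zero, Cardinal.lift_id, Nat.cast_card]

end Param

/-- The orbit is the family given by the generic matrix. -/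
theorem orbit_eq_family (μ : LieLaw n) :
    orbit μ = family μ (paramMatrix (Matrix.mvPolynomialX (Fin n) (Fin n) ℂ)) := by
  refine (family_subset_orbit μ _).antisymm' fun ν hν => ?_
  obtain ⟨X, rfl⟩ := exists_transport_eq hν
  let t : Fin n × Fin n → ℂ := fun p => X.val p.1 p.2
  have hX : (Matrix.mvPolynomialX (Fin n) (Fin n) ℂ).map (MvPolynomial.eval t) = X.val := by
    ext i j
    simp [t, Matrix.mvPolynomialX_apply]
  have ht : MvPolynomial.eval t (Matrix.mvPolynomialX (Fin n) (Fin n) ℂ).det ≠ 0 := by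
    rw [RingHom.map_det, RingHom.mapMatrix_apply, hX]
    exact ((Matrix.isUnit_iff_isUnit_det _).mp X.isUnit).ne_zero
  have hXe : Matrix.GeneralLinearGroup.map (evalParam _ t ht : _ →+* ℂ)
      (paramMatrix (Matrix.mvPolynomialX (Fin n) (Fin n) ℂ)) = X :=
    Units.ext ((map_evalParam_paramMatrix _ t ht).trans hX)
  exact ⟨evalParam _ t ht, congrArg (transport μ) hXe⟩

/-! ### Upper bound for the dimension of an orbit -/

/-- A derivation of `μ` extends to a derivation of the extension of `μ` to `R`. -/
theorem bracket_derivation {R : Type*} [CommRing R] [Algebra ℂ R] (μ : LieLaw n)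
    {V : Matrix (Fin n) (Fin n) ℂ} (hV : Matrix.toLin' V ∈ LinearMap.ker (delta1 μ))
    (v w : Fin n → R) :
    bracket μ ((V.map (algebraMap ℂ R)).mulVec v) w +
      bracket μ v ((V.map (algebraMap ℂ R)).mulVec w) =
      (V.map (algebraMap ℂ R)).mulVec (bracket μ v w) := by
  have hexp : ∀ v : Fin n → R, v = ∑ a, v a • (Pi.single a 1 : Fin n → R) := fun v => by
    ext t
    simp [Finset.sum_apply, Pi.single_apply]
  have hs : ∀ a, (Pi.single a 1 : Fin n → R) = Algebra.ofId ℂ R ∘ Pi.single a 1 := fun a => by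
    ext t
    rcases eq_or_ne t a with rfl | h <;> simp [*]
  have hV' : V.map (algebraMap ℂ R) = V.map (Algebra.ofId ℂ R) := rfl
  have hm : ∀ u : Fin n → ℂ, (V.map (Algebra.ofId ℂ R)).mulVec (Algebra.ofId ℂ R ∘ u) =
      Algebra.ofId ℂ R ∘ V.mulVec u := fun u => by
    ext k
    exact (RingHom.map_mulVec (Algebra.ofId ℂ R : ℂ →+* R) V u k).symm
  have key : ∀ a b, bracket μ ((V.map (algebraMap ℂ R)).mulVec (Pi.single a 1)) (Pi.single b 1) +
      bracket μ (Pi.single a 1) ((V.map (algebraMap ℂ R)).mulVec (Pi.single b 1)) =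
      (V.map (algebraMap ℂ R)).mulVec (bracket μ (Pi.single a 1) (Pi.single b 1)) := by
    intro a b
    have h := congrArg (fun f => f (Pi.single a 1) (Pi.single b 1)) (LinearMap.mem_ker.mp hV)
    simp only [delta1_apply, Matrix.toLin'_apply, LinearMap.zero_apply] at h
    rw [hs, hs, hV', hm, hm, ← map_bracket, ← map_bracket, ← map_bracket, hm, bracket_complex,
      bracket_complex, bracket_complex]
    ext k
    have h' := congrFun h k
    simp only [Pi.add_apply, Pi.neg_apply, Pi.zero_apply] at h'
    simp only [Pi.add_apply, Function.comp_apply, ← map_add]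
    congr 1
    linear_combination h'
  have key2 : ∀ a, ∀ w : Fin n → R, bracket μ ((V.map (algebraMap ℂ R)).mulVec (Pi.single a 1)) w +
      bracket μ (Pi.single a 1) ((V.map (algebraMap ℂ R)).mulVec w) =
      (V.map (algebraMap ℂ R)).mulVec (bracket μ (Pi.single a 1) w) := by
    intro a w
    rw [hexp w]
    simp only [bracket_sum_smul_right, Matrix.mulVec_sum, Matrix.mulVec_smul,
      ← Finset.sum_add_distrib, ← smul_add, key]
  rw [hexp v]
  simp only [bracket_sum_smul_left, Matrix.mulVec_sum, Matrix.mulVec_smul,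
      ← Finset.sum_add_distrib, ← smul_add, key2]

/-- The transported law does not vary along `V X` when `V` is a derivation of `μ`, since
`exp(tV)` is an automorphism of `μ`. -/
theorem variation_mul_eq_zero {R : Type*} [CommRing R] [Algebra ℂ R] (μ : LieLaw n)
    {V : Matrix (Fin n) (Fin n) ℂ} (hV : Matrix.toLin' V ∈ LinearMap.ker (delta1 μ))
    (X : GL (Fin n) R) (i j : Fin n) :
    variation μ X (V.map (algebraMap ℂ R) * X.val) i j = 0 := by
  have hc : ∀ i, (V.map (algebraMap ℂ R) * X.val).col i =
    (V.map (algebraMap ℂ R)).mulVec (X.val.col i) := fun i => rfl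
  rw [variation, hc, hc, bracket_derivation μ hV, ← Matrix.mulVec_mulVec, mulVec_transported,
    sub_self]

/-- A space of endomorphisms has a basis of matrices together with a dual family. -/
theorem exists_matrices_dual (W : Submodule ℂ ((Fin n → ℂ) →ₗ[ℂ] (Fin n → ℂ))) :
    ∃ (V : Fin (Module.finrank ℂ W) → Matrix (Fin n) (Fin n) ℂ)
      (Q : Fin (Module.finrank ℂ W) → Fin n × Fin n → ℂ), (∀ c, Matrix.toLin' (V c) ∈ W) ∧
      ∀ a b, ∑ p, Q a p * V b p.1 p.2 = if a = b then 1 else 0 := by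
  let b := Module.finBasis ℂ W
  have hb : LinearIndependent ℂ fun c => (b c : (Fin n → ℂ) →ₗ[ℂ] (Fin n → ℂ)) :=
    b.linearIndependent.map' W.subtype (Submodule.ker_subtype _)
  let E : ((Fin n → ℂ) →ₗ[ℂ] (Fin n → ℂ)) →ₗ[ℂ] (Fin n × Fin n → ℂ) :=
    { toFun := fun g p => LinearMap.toMatrix' g p.1 p.2
      map_add' := fun g g' => by ext; simp
      map_smul' := fun r g => by ext; simp }
  have hE : LinearMap.ker E = ⊥ := LinearMap.ker_eq_bot.mpr fun g g' hg =>
    LinearMap.toMatrix'.injective (Matrix.ext fun i j => congrFun hg (i, j))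
  obtain ⟨Q, hQ⟩ := (hb.map' E hE).exists_dual_family
  refine ⟨fun c => LinearMap.toMatrix' (b c).1, Q, fun c => ?_, hQ⟩
  rw [Matrix.toLin'_toMatrix']
  exact (b c).2

/-- The dimension of the closure of the orbit of `μ` is at most the rank of `δ¹`: the derivations
of the function field of `GL(n)` induced by the derivations of `μ` kill the functions pulled back
from the orbit. -/
theorem ringKrullDim_quotient_vanIdeal_orbit_le (μ : LieLaw n) :
    ringKrullDim (MvPolynomial (StructIdx n) ℂ ⧸ vanIdeal (orbit μ)) ≤ rank1 μ := by
  let F := Matrix.mvPolynomialX (Fin n) (Fin n) ℂ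
  have hF : F.det ≠ 0 := Matrix.det_mvPolynomialX_ne_zero (Fin n) ℂ
  have := isDomain_paramRing hF
  rw [orbit_eq_family, vanIdeal_family]
  let φ := MvPolynomial.aeval (R := ℂ) (transportedCoords μ (paramMatrix F))
  change ringKrullDim (_ ⧸ RingHom.ker φ) ≤ _
  have : (RingHom.ker φ).IsPrime := RingHom.ker_isPrime _
  obtain ⟨s, h, hinj, hfin⟩ := exists_finite_inj_algHom_of_fg ℂ
    (MvPolynomial (StructIdx n) ℂ ⧸ RingHom.ker φ)
  have hle := ringKrullDim_le_of_isIntegral h.toRingHom (RingHom.Finite.to_isIntegral hfin)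
  rw [MvPolynomial.ringKrullDim_of_isNoetherianRing, ringKrullDim_eq_zero_of_field, zero_add,
    Nat.card_fin] at hle
  refine hle.trans ?_
  suffices hs : s ≤ rank1 μ by exact_mod_cast hs
  let ψ : (MvPolynomial (StructIdx n) ℂ ⧸ RingHom.ker φ) →ₐ[ℂ] ParamField F :=
    (IsScalarTower.toAlgHom ℂ (ParamRing F) (ParamField F)).comp (Ideal.kerLiftAlg φ)
  have hψ : Function.Injective ψ :=
    (IsFractionRing.injective (ParamRing F) (ParamField F)).comp (Ideal.kerLiftAlg_injective φ)
  let y : Fin s → ParamField F := fun i => ψ (h (MvPolynomial.X i))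
  have hy : AlgebraicIndependent ℂ y := by
    have : MvPolynomial.aeval y = ψ.comp h := by
      ext i
      simp [y]
    unfold AlgebraicIndependent
    rw [this]
    exact hψ.comp hinj
  let e : ParamRing F →ₐ[ℂ] ParamField F := IsScalarTower.toAlgHom ℂ (ParamRing F) (ParamField F)
  let X : GL (Fin n) (ParamField F) :=
    Matrix.GeneralLinearGroup.map (e : ParamRing F →+* ParamField F) (paramMatrix F)
  have hX : ∀ i j, X.val i j = algebraMap (MvPolynomial (Fin n × Fin n) ℂ) (ParamField F)
      (MvPolynomial.X (i, j)) := fun i j => by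
    rw [IsScalarTower.algebraMap_apply _ (ParamRing F) (ParamField F)]
    rfl
  have hyX : ∀ i, ∃ P, y i = MvPolynomial.aeval (transportedCoords μ X) P := fun i => by
    obtain ⟨P, hP⟩ := Ideal.Quotient.mk_surjective (h (MvPolynomial.X i))
    refine ⟨P, ?_⟩
    have h1 : y i = e (φ P) := by
      change ψ (h _) = _
      rw [← hP]
      rfl
    rw [h1, ← map_transportedCoords]
    exact MvPolynomial.comp_aeval_apply (transportedCoords μ (paramMatrix F)) e P
  obtain ⟨V, Q, hV, hQ⟩ := exists_matrices_dual (LinearMap.ker (delta1 μ))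
  -- the derivation of the function field induced by `V c` maps the generic matrix `X` to `V c * X`
  have hD : ∀ c, ∃ d : Derivation ℂ (ParamField F) (ParamField F), X.val.map d =
      (V c).map (algebraMap ℂ (ParamField F)) * X.val := fun c => by
    obtain ⟨d, hd⟩ := Derivation.exists_extend_of_formallyEtale
      (MvPolynomial.mkDerivation ℂ fun p : Fin n × Fin n =>
        ((V c).map (algebraMap ℂ (ParamField F)) * X.val) p.1 p.2)
    refine ⟨d, ?_⟩
    ext i j
    rw [Matrix.map_apply, hX, hd, MvPolynomial.mkDerivation_X]
  choose D hD using hD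
  have hkill : ∀ c i, D c (y i) = 0 := fun c i => by
    obtain ⟨P, hP⟩ := hyX i
    rw [hP]
    refine derivation_aeval_eq_zero _ (fun p => ?_) P
    have h1 := mulVec_derivation_transported μ (D c) X p.1.1.1 p.1.1.2
    rw [hD, variation_mul_eq_zero μ (hV c)] at h1
    have h2 := congrArg (X⁻¹).val.mulVec h1
    rw [Matrix.mulVec_mulVec, ← Units.val_mul, inv_mul_cancel, Units.val_one, Matrix.one_mulVec,
      Matrix.mulVec_zero] at h2
    exact congrFun h2 p.2
  have hli : LinearIndependent (ParamField F) D := by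
    rw [Fintype.linearIndependent_iff]
    intro k hk a
    have h1 : (∑ c, k c • (V c).map (algebraMap ℂ (ParamField F))) * X.val = 0 := by
      rw [Finset.sum_mul]
      simp only [Matrix.smul_mul, ← hD]
      ext i j
      have := DFunLike.congr_fun hk (X.val i j)
      rw [← Derivation.coeFnAddMonoidHom_apply, map_sum, Finset.sum_apply] at this
      rw [Matrix.sum_apply]
      exact this
    have h2 : (∑ c, k c • (V c).map (algebraMap ℂ (ParamField F))) = 0 := by
      have := congrArg (· * (X⁻¹).val) h1
      simpa [mul_assoc, ← Units.val_mul] using this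
    have h3 : ∑ p : Fin n × Fin n, algebraMap ℂ (ParamField F) (Q a p) *
        (∑ c, k c • (V c).map (algebraMap ℂ (ParamField F))) p.1 p.2 = k a := by
      simp only [Matrix.sum_apply, Matrix.smul_apply, Matrix.map_apply, smul_eq_mul,
        Finset.mul_sum]
      rw [Finset.sum_comm]
      have : ∀ c, ∑ p : Fin n × Fin n, algebraMap ℂ (ParamField F) (Q a p) *
          (k c * algebraMap ℂ (ParamField F) (V c p.1 p.2)) = if a = c then k c else 0 := by
        intro c
        have h4 := congrArg (algebraMap ℂ (ParamField F)) (hQ a c)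
        rw [map_sum] at h4
        calc _ = k c * ∑ p : Fin n × Fin n, algebraMap ℂ (ParamField F) (Q a p * V c p.1 p.2) := by
              rw [Finset.mul_sum]
              exact Finset.sum_congr rfl fun p _ => by rw [map_mul]; ring
          _ = _ := by rw [h4]; split_ifs <;> simp
      simp [this]
    rw [← h3, h2]
    simp
  have hcount := hy.add_le_trdeg_of_derivation (N := n ^ 2)
    (by rw [trdeg_paramField hF]; simp [sq]) D hkill hli
  have := rank1_add_finrank_ker μ
  omega

/-! ### Lower bound for the dimension of an orbit -/

section Affine

variable {m : ℕ} (v : Fin m → Matrix (Fin n) (Fin n) ℂ)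

/-- The generic point `1 + ∑ t_c v_c` of the affine space through the identity directed by the
matrices `v_c`. -/
noncomputable def affineMatrix : Matrix (Fin n) (Fin n) (MvPolynomial (Fin m) ℂ) :=
  1 + ∑ c, (MvPolynomial.X c : MvPolynomial (Fin m) ℂ) • (v c).map MvPolynomial.C

theorem affineMatrix_map_eval (t : Fin m → ℂ) :
    (affineMatrix v).map (MvPolynomial.eval t) = 1 + ∑ c, t c • v c := by
  ext i j
  simp [affineMatrix, Matrix.sum_apply, Matrix.one_apply, apply_ite]

theorem eval_det_affineMatrix (t : Fin m → ℂ) :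
    MvPolynomial.eval t (affineMatrix v).det = (1 + ∑ c, t c • v c).det := by
  rw [RingHom.map_det, RingHom.mapMatrix_apply, affineMatrix_map_eval]

theorem eval_zero_det_affineMatrix : MvPolynomial.eval 0 (affineMatrix v).det ≠ 0 := by
  rw [eval_det_affineMatrix]
  simp

theorem det_affineMatrix_ne_zero : (affineMatrix v).det ≠ 0 := fun h =>
  eval_zero_det_affineMatrix v (by rw [h, map_zero])

/-- If the images of the directions `v_c` under `δ¹` are linearly independent, the family of laws
parametrized by the affine space they span has as many independent parameters as directions:
a derivation of the function field that kills the structure constants of the generic member kills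
the parameters, since it does so to first order at the identity. -/
theorem trdeg_quotient_vanIdeal_family (μ : LieLaw n)
    (hv : LinearIndependent ℂ fun c => entries (delta1 μ (Matrix.toLin' (v c)))) :
    Algebra.trdeg ℂ (MvPolynomial (StructIdx n) ℂ ⧸
      vanIdeal (family μ (paramMatrix (affineMatrix v)))) = m := by
  have hF := det_affineMatrix_ne_zero v
  have := isDomain_paramRing hF
  set F := affineMatrix v with hFdef
  let e : ParamRing F →ₐ[ℂ] ParamField F := IsScalarTower.toAlgHom ℂ (ParamRing F) (ParamField F)
  have he : Function.Injective e := IsFractionRing.injective (ParamRing F) (ParamField F)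
  let X : GL (Fin n) (ParamField F) :=
    Matrix.GeneralLinearGroup.map (e : ParamRing F →+* ParamField F) (paramMatrix F)
  let e₀ : ParamRing F →ₐ[ℂ] ℂ := evalParam F 0 (eval_zero_det_affineMatrix v)
  have he₀ : Matrix.GeneralLinearGroup.map (e₀ : ParamRing F →+* ℂ) (paramMatrix F) = 1 :=
    Units.ext ((map_evalParam_paramMatrix F 0 (eval_zero_det_affineMatrix v)).trans (by
      rw [hFdef, affineMatrix_map_eval]; simp))
  let τ : Fin m → ParamField F := fun c =>
    algebraMap (MvPolynomial (Fin m) ℂ) (ParamField F) (MvPolynomial.X c)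
  have hX : X.val = 1 + ∑ c, τ c • (v c).map (algebraMap ℂ (ParamField F)) := by
    ext i j
    have : X.val i j = algebraMap (MvPolynomial (Fin m) ℂ) (ParamField F) (F i j) := by
      rw [IsScalarTower.algebraMap_apply _ (ParamRing F) (ParamField F)]
      rfl
    have hFij : F i j = (1 : Matrix (Fin n) (Fin n) (MvPolynomial (Fin m) ℂ)) i j +
        ∑ c, MvPolynomial.X c * MvPolynomial.C (v c i j) := by
      rw [hFdef]
      simp [affineMatrix, Matrix.sum_apply]
    rw [this, hFij]
    simp only [Matrix.add_apply, Matrix.sum_apply, Matrix.smul_apply, Matrix.map_apply, smul_eq_mul,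
      map_add, map_sum, map_mul, τ]
    congr 1
    simp [Matrix.one_apply, apply_ite]
  -- the derivatives of the structure constants along `v_c`, normalized at the identity
  obtain ⟨Q, hQ⟩ := hv.exists_dual_family
  let M : Matrix (Fin m) (Fin m) (ParamRing F) := Matrix.of fun a c =>
    ∑ x : Fin n × Fin n × Fin n, algebraMap ℂ (ParamRing F) (Q a x) *
      variation μ (paramMatrix F) ((v c).map (algebraMap ℂ (ParamRing F))) x.1 x.2.1 x.2.2
  have hM : M.det ≠ 0 := by
    intro h0
    have h1 : M.map e₀ = 1 := by
      ext a c
      simp only [M, Matrix.map_apply, Matrix.of_apply, map_sum, map_mul, AlgHom.commutes,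
        Matrix.one_apply, ← hQ a c]
      refine Finset.sum_congr rfl fun x _ => ?_
      have h2 := congrFun (map_variation μ e₀ (paramMatrix F)
        ((v c).map (algebraMap ℂ (ParamRing F))) x.1 x.2.1) x.2.2
      have h3 : ((v c).map (algebraMap ℂ (ParamRing F))).map e₀ = v c := by
        ext i j
        simp
      rw [he₀, h3, variation_one] at h2
      exact congrArg (_ * ·) h2
    have h2 := RingHom.map_det (e₀ : ParamRing F →+* ℂ) M
    rw [h0, map_zero, RingHom.mapMatrix_apply] at h2
    have h3 : M.map (e₀ : ParamRing F →+* ℂ) = 1 := h1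
    rw [h3, Matrix.det_one] at h2
    exact zero_ne_one h2
  have hMK : (M.map e).det ≠ 0 := by
    have h2 := RingHom.map_det (e : ParamRing F →+* ParamField F) M
    intro h0
    refine hM (he ?_)
    rw [map_zero]
    exact h2.trans h0
  let cK := transportedCoords μ X
  have hder : ∀ d : Derivation ℂ (ParamField F) (ParamField F),
      (∀ x ∈ IntermediateField.adjoin ℂ (Set.range cK), d x = 0) → d = 0 := by
    intro d hd
    have hd1 : ∀ i j, d ∘ transported μ X i j = 0 := fun i j => funext fun k => by
      rw [Function.comp_apply, ← aeval_transportedCoords_structVar]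
      exact derivation_aeval_eq_zero d (fun p => hd _
        (IntermediateField.subset_adjoin _ _ ⟨p, rfl⟩)) _
    have hdX : X.val.map d = ∑ c, d (τ c) • (v c).map (algebraMap ℂ (ParamField F)) := by
      rw [hX]
      ext i j
      simp [Matrix.sum_apply, Matrix.one_apply, apply_ite, mul_comm]
    have hvar : ∀ i j, ∑ c, d (τ c) •
        variation μ X ((v c).map (algebraMap ℂ (ParamField F))) i j = 0 := fun i j => by
      rw [← variation_sum_smul, ← hdX, ← mulVec_derivation_transported, hd1, Matrix.mulVec_zero]
    have hMd : (M.map e).mulVec (d ∘ τ) = 0 := by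
      ext a
      have hMe : ∀ c, e (M a c) = ∑ x : Fin n × Fin n × Fin n, algebraMap ℂ (ParamField F) (Q a x) *
          variation μ X ((v c).map (algebraMap ℂ (ParamField F))) x.1 x.2.1 x.2.2 := fun c => by
        simp only [M, Matrix.of_apply, map_sum, map_mul, AlgHom.commutes]
        refine Finset.sum_congr rfl fun x _ => ?_
        have h2 := congrFun (map_variation μ e (paramMatrix F)
          ((v c).map (algebraMap ℂ (ParamRing F))) x.1 x.2.1) x.2.2
        have h3 : ((v c).map (algebraMap ℂ (ParamRing F))).map e =
            (v c).map (algebraMap ℂ (ParamField F)) := by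
          ext i j
          simp
        rw [h3] at h2
        exact congrArg (_ * ·) h2
      simp only [Matrix.mulVec, dotProduct, Matrix.map_apply, hMe, Function.comp_apply,
        Finset.sum_mul, Pi.zero_apply]
      rw [Finset.sum_comm]
      refine Finset.sum_eq_zero fun x _ => ?_
      have h4 := congrFun (hvar x.1 x.2.1) x.2.2
      simp only [Finset.sum_apply, Pi.smul_apply, smul_eq_mul, Pi.zero_apply] at h4
      rw [← mul_zero (algebraMap ℂ (ParamField F) (Q a x)), ← h4, Finset.mul_sum]
      exact Finset.sum_congr rfl fun c _ => by ring
    have hτ : ∀ c, d (τ c) = 0 := congrFun (Matrix.eq_zero_of_mulVec_eq_zero hMK hMd)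
    refine d.eq_zero_of_formallyUnramified (S := MvPolynomial (Fin m) ℂ) fun P => ?_
    have hP : algebraMap (MvPolynomial (Fin m) ℂ) (ParamField F) P = MvPolynomial.aeval τ P := by
      have : IsScalarTower.toAlgHom ℂ (MvPolynomial (Fin m) ℂ) (ParamField F) =
          MvPolynomial.aeval τ := by
        ext c
        simp [τ]
      exact DFunLike.congr_fun this P
    rw [hP]
    exact derivation_aeval_eq_zero d hτ P
  have halg := isAlgebraic_of_derivation_eq_zero _ hder
  rw [IntermediateField.isAlgebraic_adjoin_iff_top] at halg
  have hker : vanIdeal (family μ (paramMatrix F)) =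
      RingHom.ker (MvPolynomial.aeval (R := ℂ) cK) := by
    rw [vanIdeal_family]
    ext P
    rw [RingHom.mem_ker, RingHom.mem_ker]
    have : MvPolynomial.aeval cK P =
        e (MvPolynomial.aeval (transportedCoords μ (paramMatrix F)) P) := by
      rw [show cK = e ∘ transportedCoords μ (paramMatrix F) from (map_transportedCoords μ e _).symm]
      exact (MvPolynomial.comp_aeval_apply (transportedCoords μ (paramMatrix F)) e P).symm
    rw [this, map_eq_zero_iff e he]
  rw [hker]
  rw [trdeg_quotient_ker_aeval, trdeg_paramField hF, Nat.card_fin]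

end Affine

/-- Setting the last parameters to zero yields the family with fewer directions. -/
theorem family_affineMatrix_subset (μ : LieLaw n) {a b r : ℕ} (v : Fin r → Matrix (Fin n) (Fin n) ℂ)
    (hab : a ≤ b) (hb : b ≤ r) :
    family μ (paramMatrix (affineMatrix fun c : Fin a => v (Fin.castLE (hab.trans hb) c))) ⊆
      family μ (paramMatrix (affineMatrix fun c : Fin b => v (Fin.castLE hb c))) := by
  rintro _ ⟨e, rfl⟩
  obtain ⟨t, ht, rfl⟩ := exists_eq_evalParam _ e
  let t' : Fin b → ℂ := fun c => if h : c.1 < a then t ⟨c, h⟩ else 0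
  have hsum : ∑ c, t c • v (Fin.castLE (hab.trans hb) c) = ∑ c, t' c • v (Fin.castLE hb c) := by
    refine Fintype.sum_of_injective (Fin.castLE hab) (Fin.castLE_injective hab) _ _
      (fun c hc => ?_) fun c => ?_
    · have : ¬ c.1 < a := fun h => hc ⟨⟨c, h⟩, rfl⟩
      simp [t', this]
    · simp [t']
  have ht' : MvPolynomial.eval t' (affineMatrix fun c : Fin b => v (Fin.castLE hb c)).det ≠ 0 := by
    rw [eval_det_affineMatrix] at ht ⊢
    rwa [← hsum]
  refine ⟨evalParam _ t' ht', congrArg (transport μ) (Units.ext ?_)⟩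
  rw [map_evalParam_paramMatrix, map_evalParam_paramMatrix, affineMatrix_map_eval,
    affineMatrix_map_eval, hsum]

/-- Lower bound for the dimension of an orbit, by the closures of the images of a flag of affine
spaces transverse to the derivations of `μ`. -/
theorem le_orbitDim (μ : LieLaw n) : (rank1 μ : WithBot ℕ∞) ≤ orbitDim μ := by
  let b := Module.finBasis ℂ (LinearMap.range (delta1 μ))
  choose g hg using fun i => (b i).2
  let v : Fin (rank1 μ) → Matrix (Fin n) (Fin n) ℂ := fun c => LinearMap.toMatrix' (g c)
  have hv : LinearIndependent ℂ fun c => entries (delta1 μ (Matrix.toLin' (v c))) := by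
    have h1 := b.linearIndependent.map' (LinearMap.range (delta1 μ)).subtype
      (Submodule.ker_subtype _)
    have h2 := h1.map' entries (LinearMap.ker_eq_bot.mpr entries_injective)
    have heq : (fun c => entries (delta1 μ (Matrix.toLin' (v c)))) =
        entries ∘ (LinearMap.range (delta1 μ)).subtype ∘ b := funext fun c => by
      exact congrArg entries ((congrArg (delta1 μ) (Matrix.toLin'_toMatrix' (g c))).trans (hg c))
    rw [heq]
    exact h2
  let T : Fin (rank1 μ + 1) → Set (LieLaw n) := fun i =>
    family μ (paramMatrix (affineMatrix fun c : Fin i => v (Fin.castLE (Nat.lt_succ_iff.mp i.2) c)))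
  have htr : ∀ i, Algebra.trdeg ℂ (MvPolynomial (StructIdx n) ℂ ⧸ vanIdeal (T i)) = (i : ℕ) :=
    fun i => trdeg_quotient_vanIdeal_family _ μ (hv.comp _ (Fin.castLE_injective _))
  refine le_topologicalKrullDim T (fun i => family_subset_orbit μ _) (fun i => ?_)
    fun i j hij => ?_
  · have := isDomain_paramRing (det_affineMatrix_ne_zero
      fun c : Fin i => v (Fin.castLE (Nat.lt_succ_iff.mp i.2) c))
    simp only [T, vanIdeal_family]
    exact RingHom.ker_isPrime _
  · refine lt_of_le_of_ne (vanIdeal_anti (family_affineMatrix_subset μ v hij.le _)) fun h => ?_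
    have h1 := htr i
    simp only at h
    rw [← h, htr j] at h1
    exact hij.ne' (Fin.ext (by exact_mod_cast h1))

theorem orbitDim_eq_rank1 (μ : LieLaw n) : orbitDim μ = rank1 μ :=
  le_antisymm ((topologicalKrullDim_le_ringKrullDim _).trans
    (ringKrullDim_quotient_vanIdeal_orbit_le μ)) (le_orbitDim μ)

/-! ### Orbits in the closure of an orbit -/

/-- The ideal of an orbit only grows on the orbits contained in its closure, the action being by
linear transformations of the structure constants. -/
theorem vanIdeal_orbit_le_of_mem_closure {μ ν : LieLaw n} (h : μ ∈ closure (orbit ν)) :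
    vanIdeal (orbit ν) ≤ vanIdeal (orbit μ) := by
  rintro P hP _ hκ
  obtain ⟨X, rfl⟩ := exists_transport_eq hκ
  let c : StructIdx n → MvPolynomial (StructIdx n) ℂ := fun p =>
    ∑ s, MvPolynomial.C ((X⁻¹).val p.2 s) * ∑ a, ∑ b, structVar a b s *
      MvPolynomial.C (X.val a p.1.1.1) * MvPolynomial.C (X.val b p.1.1.2)
  have hc : ∀ κ : LieLaw n, (fun p => MvPolynomial.eval κ.coords (c p)) =
      (transport κ X).coords := fun κ => funext fun p => by
    rw [coords_transport]
    simp only [c, map_sum, map_mul, MvPolynomial.eval_C, eval_structVar]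
    rfl
  have hev : ∀ κ : LieLaw n, MvPolynomial.eval κ.coords (MvPolynomial.bind₁ c P) =
      MvPolynomial.eval (transport κ X).coords P := fun κ => by
    rw [← hc]
    exact MvPolynomial.eval₂Hom_bind₁ _ _ _ _
  rw [← hev]
  refine mem_closure_iff_vanIdeal.mp h _ fun κ hκ => ?_
  rw [hev]
  exact hP _ (Isomorphic.trans hκ (transport_mem_orbit κ X))

theorem vanIdeal_orbit_isPrime (μ : LieLaw n) : (vanIdeal (orbit μ)).IsPrime := by
  have := isDomain_paramRing (Matrix.det_mvPolynomialX_ne_zero (Fin n) ℂ)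
  rw [orbit_eq_family, vanIdeal_family]
  exact RingHom.ker_isPrime _

/-- An orbit in the closure of an orbit of the same dimension has the same closure. -/
theorem vanIdeal_orbit_eq_of_mem_closure {μ ν : LieLaw n} (h : μ ∈ closure (orbit ν))
    (hr : rank1 ν = rank1 μ) : vanIdeal (orbit ν) = vanIdeal (orbit μ) := by
  have hle := vanIdeal_orbit_le_of_mem_closure h
  refine hle.antisymm ?_
  by_contra hlt
  obtain ⟨P, hP, hP'⟩ := SetLike.not_le_iff_exists.mp hlt
  have := vanIdeal_orbit_isPrime ν
  have h1 := ringKrullDim_succ_le_of_surjective (Ideal.Quotient.factor hle)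
    (Ideal.Quotient.factor_surjective hle) (r := Ideal.Quotient.mk _ P)
    (mem_nonZeroDivisors_of_ne_zero (mt Ideal.Quotient.eq_zero_iff_mem.mp hP'))
    (by rw [Ideal.Quotient.factor_mk]; exact Ideal.Quotient.eq_zero_iff_mem.mpr hP)
  have h2 := ringKrullDim_quotient_vanIdeal_orbit_le ν
  have h3 : (rank1 μ : WithBot ℕ∞) ≤ ringKrullDim (_ ⧸ vanIdeal (orbit μ)) :=
    (le_orbitDim μ).trans (topologicalKrullDim_le_ringKrullDim _)
  rw [hr] at h2
  have h4 : ((rank1 μ + 1 : ℕ) : WithBot ℕ∞) ≤ (rank1 μ : ℕ) := by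
    push_cast
    exact (add_le_add_left h3 1).trans (h1.trans h2)
  have h5 : rank1 μ + 1 ≤ rank1 μ := by exact_mod_cast h4
  omega

/-- Two orbits with the same closure coincide, each containing a nonempty open subset of it. -/
theorem isomorphic_of_vanIdeal_orbit_eq {μ ν : LieLaw n}
    (h : vanIdeal (orbit ν) = vanIdeal (orbit μ)) : Isomorphic μ ν := by
  have := isDomain_paramRing (Matrix.det_mvPolynomialX_ne_zero (Fin n) ℂ)
  let X := paramMatrix (Matrix.mvPolynomialX (Fin n) (Fin n) ℂ)
  obtain ⟨P, hP, hex⟩ := exists_forall_exists_comp_eq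
    (MvPolynomial.aeval (R := ℂ) (transportedCoords ν X))
  have hker : vanIdeal (orbit ν) =
      RingHom.ker (MvPolynomial.aeval (R := ℂ) (transportedCoords ν X)) := by
    rw [orbit_eq_family, vanIdeal_family]
  have hP' : P ∉ vanIdeal (orbit μ) := by
    rw [← h, hker]
    exact hP
  obtain ⟨κ, hκ, hκP⟩ : ∃ κ ∈ orbit μ, MvPolynomial.eval κ.coords P ≠ 0 := by
    simpa [mem_vanIdeal] using hP'
  obtain ⟨q, hq⟩ := hex (MvPolynomial.aeval κ.coords) hκP (by
    rw [← hker, h]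
    exact fun Q hQ => hQ κ hκ)
  have hκν : κ = transport ν (Matrix.GeneralLinearGroup.map (q : _ →+* ℂ) X) := by
    refine coords_injective (funext fun p => ?_)
    rw [coords_transport, ← map_transportedCoords]
    have := DFunLike.congr_fun hq (MvPolynomial.X p)
    simpa using this.symm
  have hκ' : κ ∈ orbit ν := hκν ▸ transport_mem_orbit ν _
  exact Isomorphic.trans hκ (Isomorphic.symm hκ')

end LieLaw

theorem mainTheorem11 (n : ℕ) :
    (∀ x : LieScheme n, Subsingleton (LieLaw.H1 (lawOfPoint x)) →
      ∃ U : Set (LieScheme n), IsOpen U ∧ x ∈ U ∧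
        ∀ y ∈ U, LieLaw.orbitDim (lawOfPoint y) =
          ((n ^ 2 - n + Module.finrank ℂ (LieLaw.H0 (lawOfPoint x)) : ℕ) : WithBot ℕ∞)) ∧
    (∀ g g' : LieLaw n, Subsingleton (LieLaw.H1 g) → LieLaw.IsContraction g g' →
      LieLaw.Isomorphic g g') := by
  refine ⟨fun x hx => ?_, fun g g' hg hgg' => ?_⟩
  · obtain ⟨P, hP, hP'⟩ := LieLaw.exists_polynomial_rank1_eq (lawOfPoint x) hx
    -- the principal open set of `P` in `Spm A(Lⁿ)`
    let U : Set (LieScheme n) := {y | Ideal.Quotient.mk (jacobiIdeal n) P ∉ y.asIdeal}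
    have hU : ∀ y, y ∈ U ↔ MvPolynomial.eval (lawOfPoint y).coords P ≠ 0 := fun y => by
      conv_lhs => rw [← (pointEquiv n).apply_symm_apply y]
      exact Iff.rfl
    refine ⟨U, ?_, (hU x).mpr hP, fun y hy => ?_⟩
    · exact (PrimeSpectrum.basicOpen (Ideal.Quotient.mk (jacobiIdeal n) P)).isOpen.preimage
        MaximalSpectrum.toPrimeSpectrum_continuous
    · rw [LieLaw.orbitDim_eq_rank1, hP' _ ((hU y).mp hy)]
      have h1 := LieLaw.rank0_add_rank1_of_H1 _ hx
      have h2 := LieLaw.rank0_add_finrank_H0 (lawOfPoint x)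
      have h3 : n ≤ n ^ 2 := Nat.le_self_pow two_ne_zero n
      congr 2
      omega
  · obtain ⟨P, hP, hP'⟩ := LieLaw.exists_polynomial_rank1_eq g hg
    obtain ⟨ν, hν, hνP⟩ : ∃ ν ∈ LieLaw.orbit g', MvPolynomial.eval ν.coords P ≠ 0 := by
      by_contra! hall
      exact hP (LieLaw.mem_closure_iff_vanIdeal.mp hgg' P hall)
    rw [LieLaw.IsContraction, LieLaw.orbit_eq_of_isomorphic hν] at hgg'
    exact (LieLaw.isomorphic_of_vanIdeal_orbit_eq
      (LieLaw.vanIdeal_orbit_eq_of_mem_closure hgg' (hP' ν hνP))).trans hν.symm
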